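/- **Setting.** Let $\mathfrak e_{8(8)}=\mathfrak{so}(16)\oplus\mathbf{128}$, with compact generators $X^{IJ}=-X^{JI}$ ($I,J=1,\dots,16$) and non-compact generators $Y^A$ ($A=1,\dots,128$) in a real Majorana–Weyl spinor representation of $\mathfrak{so}(16)$. Here $\Gamma^I_{\dot AA}$ are real chiral gamma matrices of $SO(16)$, $\Gamma^{IJ}_{AB}=\frac12(\Gamma^I_{A\dot A}\Gamma^J_{\dot AB}-\Gamma^J_{A\dot A}\Gamma^I_{\dot AB})$, $[X^{IJ},Y^A]=-\frac12\Gamma^{IJ}_{AB}Y^B$ and $[Y^A,Y^B]=\frac12\sum_{I<J}\Gamma^{IJ}_{AB}X^{IJ}$. The bosonic fields of three-dimensional maximal supergravity are a Lorentzian metric $g_{\mu\nu}$ (mostly plus) and a smooth scalar coset representative $V\in E_{8(8)}(\mathbb R)$ of $E_{8(8)}/SO(16)$, with $V^{-1}\partial_\mu V=P_\mu^AY^A+\frac12Q_\mu^{IJ}X^{IJ}$. The field equations are $R_{\mu\nu}=P_\mu^AP_\nu^A$ and $\nabla_\mu P^\mu+[Q_\mu,P^\mu]=0$. For a vielbein $e^a_\mu$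 of $g$ with spin connection $\omega_\mu^{ab}$, the preserved supersymmetries are the elements of the real vector space of Killing spinors: sixteen two-component Majorana spinors $\epsilon^I$ (32 real components) with $$\partial_\mu\epsilon^I+\tfrac14\omega_\mu^{ab}\gamma_{ab}\epsilon^I+Q_\mu^{IJ}\epsilon^J=0,\qquad \gamma^\mu\epsilon^I\,\Gamma^I_{\dot AA}P^A_\mu=0 .$$ **Theorem.** Let $U$ be a non-empty convex open set of coordinates $(u,v,x)$. Consider a configuration of the null class (pp-waves) on $U$: the metric is $$ds^2=-2\,du\,dv-2\,\omega(v,x)\,dv\,dx+h(v,x)\,dx^2$$ with $\omega,h$ smooth and $h>0$, and the scalars $V$ depend only on $v$. Then the only non-zero component of $P$ is $P_v=P_v(v)$, and the following hold. 1. The field equations hold on $U$ if and only if on $U$ $$\frac{(\partial_vh)^2+2\,\partial_xh\,\partial_v\omega-2h\,(2\,\partial_x\partial_v\omega+\partial_v^2h)}{4h^2}=P_v^A(v)P_v^A(v).\tag{1}$$ 2. For every solution of the field equations, and with respect to every smooth vielbein on $U$, at least $1/2$ of the supersymmetry is preserved: the space of Killing spinors on $U$ has dimension at least $16=\frac12\cdot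 32$. If $P_v$ does not vanish identically (the scalars are not constant), exactly $1/2$ is preserved: the dimension is exactly $16$. 3. Suppose the configuration is a solution, $\partial_v\omega$ has no zero on $U$, and for some constant $c$ and some $C^2$ function $f(v,x)$ the equation $$-\omega+\partial_xf+c\,\partial_v\omega-h\,\frac{\partial_v^2f}{\partial_v\omega}+h\,\frac{\partial_vf\,\partial_v^2\omega}{(\partial_v\omega)^2}=0$$ holds for all $(v,x)$ that occur on $U$. Then every value $v_0$ of $v$ on $U$ has a $\delta>0$ such that, on the whole part of $U$ where $|v-v_0|<\delta$, a smooth coordinate transformation (a diffeomorphism onto an open set) that keeps $v$ brings the metric to the form $$ds^2=-2\,du\,dv+h_0(v)^2\,dx^2$$ with $h_0$ smooth and positive on $(v_0-\delta,v_0+\delta)$. For a metric of this form equation (1) is equivalent to $$h_0''+h_0\,P_v^AP_v^A=0,$$ and this equation holds on $(v_0-\delta,v_0+\delta)$. -/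

import Mathlib

open scoped ContDiff Matrix Kronecker

namespace MaxSugra

noncomputable section

/-! ### Real chiral gamma matrices of `SO(16)` -/

/-- The antisymmetric real `2 × 2` matrix. -/
def eps : Matrix (Fin 2) (Fin 2) ℝ := !![0, 1; -1, 0]

/-- The first Pauli matrix. -/
def tauOne : Matrix (Fin 2) (Fin 2) ℝ := !![0, 1; 1, 0]

/-- The third Pauli matrix. -/
def tauThree : Matrix (Fin 2) (Fin 2) ℝ := !![1, 0; 0, -1]

/-- An index set with eight elements. -/
abbrev Oct := Fin 2 × Fin 2 × Fin 2

/-- The real `8 × 8` chiral gamma matrices `γᵃ` of `SO(8)`: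
`γᵃ (γᵇ)ᵀ + γᵇ (γᵃ)ᵀ = 2 δᵃᵇ = (γᵃ)ᵀ γᵇ + (γᵇ)ᵀ γᵃ`. -/
def gammaSO8 : Fin 8 → Matrix Oct Oct ℝ :=
  ![eps ⊗ₖ (eps ⊗ₖ eps),
    1 ⊗ₖ (tauOne ⊗ₖ eps),
    1 ⊗ₖ (tauThree ⊗ₖ eps),
    tauOne ⊗ₖ (eps ⊗ₖ 1),
    tauThree ⊗ₖ (eps ⊗ₖ 1),
    eps ⊗ₖ (1 ⊗ₖ tauOne),
    eps ⊗ₖ (1 ⊗ₖ tauThree),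
    1 ⊗ₖ (1 ⊗ₖ 1)]

/-- The index `I` of the vector representation of `SO(16)` (16 values). -/
abbrev VecIdx := Fin 8 ⊕ Fin 8

/-- The index `A` of the Majorana-Weyl spinor representation `128` of `SO(16)`. -/
abbrev SpinIdx := (Oct × Oct) ⊕ (Oct × Oct)

/-- The dotted index of the other Majorana-Weyl spinor representation `128'` of `SO(16)`. -/
abbrev CoSpinIdx := (Oct × Oct) ⊕ (Oct × Oct)

/-- The real chiral gamma matrices of `SO(16)`, with a dotted row index and an undotted
column index: `(Γᴵ)ᵀ Γᴶ + (Γᴶ)ᵀ Γᴵ = 2 δᴵᴶ = Γᴵ (Γᴶ)ᵀ + Γᴶ (Γᴵ)ᵀ`. -/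
def gammaSO16 : VecIdx → Matrix CoSpinIdx SpinIdx ℝ
  | Sum.inl a => Matrix.fromBlocks 0 (gammaSO8 a ⊗ₖ 1) ((gammaSO8 a)ᵀ ⊗ₖ 1) 0
  | Sum.inr b => Matrix.fromBlocks (1 ⊗ₖ (gammaSO8 b)ᵀ) 0 0 (-(1 ⊗ₖ gammaSO8 b))

/-- `Γᴵᴶ = ½ ((Γᴵ)ᵀ Γᴶ - (Γᴶ)ᵀ Γᴵ)`, acting on the `128`. -/
def gammaIJ (I J : VecIdx) : Matrix SpinIdx SpinIdx ℝ :=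
  (1 / 2 : ℝ) • ((gammaSO16 I)ᵀ * gammaSO16 J - (gammaSO16 J)ᵀ * gammaSO16 I)

/-! ### The Lie algebra `𝔢₈₍₈₎` and its group -/

/-- The compact subalgebra `𝔨 = 𝔰𝔬(16)`: an element `½ Qᴵᴶ Xᴵᴶ` is the antisymmetric matrix
`(Qᴵᴶ)`. -/
abbrev SO16Alg := LieAlgebra.Orthogonal.so VecIdx ℝ

/-- The vector space `𝔢₈₍₈₎ = 𝔰𝔬(16) ⊕ 128`: the pair `(Q, P)` is the element
`½ Qᴵᴶ Xᴵᴶ + Pᴬ Yᴬ`. -/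
abbrev E8Alg := SO16Alg × (SpinIdx → ℝ)

/-- The action of `Q ∈ 𝔰𝔬(16)` on the `128`. -/
def spinRep (Q : Matrix VecIdx VecIdx ℝ) : Matrix SpinIdx SpinIdx ℝ :=
  (1 / 4 : ℝ) • ∑ I, ∑ J, Q I J • gammaIJ I J

theorem gammaIJ_swap (I J : VecIdx) : gammaIJ J I = -gammaIJ I J := by
  simp only [gammaIJ, ← smul_neg, neg_sub]

/-- `[Pᴬ Yᴬ, P'ᴮ Yᴮ] = ½ ∑_{I < J} Pᴬ Γᴵᴶ_{AB} P'ᴮ Xᴵᴶ`. -/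
def noncompactBracket (p q : SpinIdx → ℝ) : SO16Alg :=
  ⟨Matrix.of fun I J => (1 / 2 : ℝ) * (p ⬝ᵥ (gammaIJ I J *ᵥ q)), by
    rw [LieAlgebra.Orthogonal.mem_so]
    ext I J
    simp only [Matrix.transpose_apply, Matrix.of_apply, Matrix.neg_apply]
    rw [gammaIJ_swap I J, Matrix.neg_mulVec, dotProduct_neg, mul_neg]⟩

/-- The Lie bracket of `𝔢₈₍₈₎`. -/
def e8Bracket (X Y : E8Alg) : E8Alg :=
  (⁅X.1, Y.1⁆ + noncompactBracket X.2 Y.2,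
    spinRep (X.1 : Matrix VecIdx VecIdx ℝ) *ᵥ Y.2
      - spinRep (Y.1 : Matrix VecIdx VecIdx ℝ) *ᵥ X.2)

/-- The group `E₈₍₈₎(ℝ)` in its (faithful) adjoint representation: since `𝔢₈` has no outer
automorphisms and trivial centre, this is the automorphism group of `𝔢₈₍₈₎`. -/
def E8Group : Subgroup (E8Alg ≃ₗ[ℝ] E8Alg) where
  carrier := {T | ∀ X Y, T (e8Bracket X Y) = e8Bracket (T X) (T Y)}
  mul_mem' := by
    intro S T hS hT X Y
    simp only [LinearEquiv.mul_apply]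
    rw [hT X Y, hS]
  one_mem' := by
    intro X Y
    rfl
  inv_mem' := by
    intro T hT X Y
    apply T.injective
    rw [hT]
    change T (T.symm _) = e8Bracket (T (T.symm X)) (T (T.symm Y))
    simp only [LinearEquiv.apply_symm_apply]

/-! ### Three-dimensional Lorentzian geometry in a coordinate patch -/

/-- Coordinates of a patch of the three-dimensional spacetime.  For the null class,
`p 0 = u`, `p 1 = v`, `p 2 = x`. -/
abbrev Spacetime := Fin 3 → ℝ

/-- The partial derivative `∂_μ F`. -/
def pd (μ : Fin 3) (F : Spacetime → ℝ) (p : Spacetime) : ℝ :=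
  fderiv ℝ F p (Pi.single μ 1)

/-- The Christoffel symbol `Γ^ρ_{μν}` of the metric `g`. -/
def christoffel (g : Spacetime → Matrix (Fin 3) (Fin 3) ℝ) (ρ μ ν : Fin 3) (p : Spacetime) : ℝ :=
  (1 / 2) * ∑ σ, (g p)⁻¹ ρ σ *
    (pd μ (fun q => g q σ ν) p + pd ν (fun q => g q σ μ) p - pd σ (fun q => g q μ ν) p)

/-- The Ricci tensor `R_{μν}` of the metric `g`. -/
def ricci (g : Spacetime → Matrix (Fin 3) (Fin 3) ℝ) (μ ν : Fin 3) (p : Spacetime) : ℝ :=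
  ∑ ρ, (pd ρ (christoffel g ρ μ ν) p - pd ν (christoffel g ρ μ ρ) p
    + ∑ l, (christoffel g ρ ρ l p * christoffel g l μ ν p
      - christoffel g ρ ν l p * christoffel g l μ ρ p))

/-- The flat metric, mostly plus. -/
def mink : Matrix (Fin 3) (Fin 3) ℝ := Matrix.diagonal ![-1, 1, 1]

/-- `e p a μ = e^a_μ(p)` is a smooth vielbein of the metric `g` on `U`. -/
structure IsVielbein (U : Set Spacetime) (g e : Spacetime → Matrix (Fin 3) (Fin 3) ℝ) : Prop where
  smooth : ∀ a μ, ContDiffOn ℝ ∞ (fun p => e p a μ) U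
  orthonormal : ∀ p ∈ U, (e p)ᵀ * mink * e p = g p

/-- The inverse vielbein with raised flat index: `invVielbein e p μ a = e^{μ a}(p)`. -/
def invVielbein (e : Spacetime → Matrix (Fin 3) (Fin 3) ℝ) (p : Spacetime) :
    Matrix (Fin 3) (Fin 3) ℝ :=
  (e p)⁻¹ * mink

/-- The spin connection `ω_μ^{ab} = e^a_ν ∇_μ e^{ν b}`. -/
def spinConnection (g e : Spacetime → Matrix (Fin 3) (Fin 3) ℝ) (μ a b : Fin 3)
    (p : Spacetime) : ℝ :=
  ∑ ν, e p a ν * (pd μ (fun q => invVielbein e q ν b) p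
    + ∑ l, christoffel g ν μ l p * invVielbein e p l b)

/-! ### The bosonic sector: gravity coupled to `E₈₍₈₎ / SO(16)` -/

/-- A smooth scalar field configuration on `U`: a coset representative `V` with values in
`E₈₍₈₎`, together with the components `P_μ` in `𝔭 = 128` and `Q_μ` in `𝔨 = 𝔰𝔬(16)` of the
Maurer-Cartan form, `V⁻¹ ∂_μ V = P_μ + Q_μ`.  In the adjoint representation this reads
`∂_μ (V y) = V [P_μ + Q_μ, y]` for every `y`, which determines `P_μ` and `Q_μ`. -/
structure IsScalarConfiguration (U : Set Spacetime) (V : Spacetime → E8Group)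
    (P : Fin 3 → Spacetime → SpinIdx → ℝ) (Q : Fin 3 → Spacetime → SO16Alg) : Prop where
  smooth_V_compact : ∀ (y : E8Alg) (I J : VecIdx), ContDiffOn ℝ ∞
    (fun p => (((V p : E8Alg ≃ₗ[ℝ] E8Alg) y).1 : Matrix VecIdx VecIdx ℝ) I J) U
  smooth_V_noncompact : ∀ (y : E8Alg) (A : SpinIdx), ContDiffOn ℝ ∞
    (fun p => ((V p : E8Alg ≃ₗ[ℝ] E8Alg) y).2 A) U
  smooth_P : ∀ μ A, ContDiffOn ℝ ∞ (fun p => P μ p A) U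
  smooth_Q : ∀ μ I J, ContDiffOn ℝ ∞ (fun p => (Q μ p : Matrix VecIdx VecIdx ℝ) I J) U
  maurerCartan_compact : ∀ p ∈ U, ∀ (μ : Fin 3) (y : E8Alg) (I J : VecIdx),
    pd μ (fun q => (((V q : E8Alg ≃ₗ[ℝ] E8Alg) y).1 : Matrix VecIdx VecIdx ℝ) I J) p
      = (((V p : E8Alg ≃ₗ[ℝ] E8Alg) (e8Bracket (Q μ p, P μ p) y)).1 :
          Matrix VecIdx VecIdx ℝ) I J
  maurerCartan_noncompact : ∀ p ∈ U, ∀ (μ : Fin 3) (y : E8Alg) (A : SpinIdx),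
    pd μ (fun q => ((V q : E8Alg ≃ₗ[ℝ] E8Alg) y).2 A) p
      = ((V p : E8Alg ≃ₗ[ℝ] E8Alg) (e8Bracket (Q μ p, P μ p) y)).2 A

/-- The field equations on `U`: the Einstein equation `R_{μν} = tr (P_μ P_ν) = P_μᴬ P_νᴬ` and
the scalar equation `∇_μ P^μ + [Q_μ, P^μ] = 0`. -/
structure FieldEquations (U : Set Spacetime) (g : Spacetime → Matrix (Fin 3) (Fin 3) ℝ)
    (P : Fin 3 → Spacetime → SpinIdx → ℝ) (Q : Fin 3 → Spacetime → SO16Alg) : Prop where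
  einstein : ∀ p ∈ U, ∀ μ ν, ricci g μ ν p = P μ p ⬝ᵥ P ν p
  scalar : ∀ p ∈ U, ∀ A, ∑ μ, ∑ ν, (g p)⁻¹ μ ν *
    (pd μ (fun q => P ν q A) p - (∑ ρ, christoffel g ρ μ ν p * P ρ p A)
      + (spinRep (Q μ p : Matrix VecIdx VecIdx ℝ) *ᵥ P ν p) A) = 0

/-! ### Supersymmetry -/

/-- The real `2 × 2` gamma matrices `γ_a` of three-dimensional Minkowski space. -/
def gammaFlat : Fin 3 → Matrix (Fin 2) (Fin 2) ℝ :=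
  ![!![0, 1; -1, 0], !![0, 1; 1, 0], !![1, 0; 0, -1]]

/-- `γ_{ab} = ½ (γ_a γ_b - γ_b γ_a)`. -/
def gammaFlat₂ (a b : Fin 3) : Matrix (Fin 2) (Fin 2) ℝ :=
  (1 / 2 : ℝ) • (gammaFlat a * gammaFlat b - gammaFlat b * gammaFlat a)

/-- The curved gamma matrices `γ^μ = e^{μ a} γ_a`. -/
def gammaCurved (e : Spacetime → Matrix (Fin 3) (Fin 3) ℝ) (μ : Fin 3) (p : Spacetime) :
    Matrix (Fin 2) (Fin 2) ℝ :=
  ∑ a, invVielbein e p μ a • gammaFlat a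

/-- Sixteen two-component Majorana spinors `εᴵ_α` (32 real components): the values of a
supersymmetry parameter. -/
abbrev SusyParam := VecIdx → Fin 2 → ℝ

/-- The gravitino variation `κ δψ_μᴵ = ∂_μ εᴵ + ¼ ω_μ^{ab} γ_{ab} εᴵ + Q_μᴵᴶ εᴶ`. -/
def gravitinoVariation (g e : Spacetime → Matrix (Fin 3) (Fin 3) ℝ)
    (Q : Fin 3 → Spacetime → SO16Alg) (ε : Spacetime → SusyParam)
    (μ : Fin 3) (I : VecIdx) (α : Fin 2) (p : Spacetime) : ℝ :=
  pd μ (fun q => ε q I α) p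
    + (1 / 4) * (∑ a, ∑ b, spinConnection g e μ a b p * (gammaFlat₂ a b *ᵥ ε p I) α)
    + ∑ J, (Q μ p : Matrix VecIdx VecIdx ℝ) I J * ε p J α

/-- The dilatino variation `γ^μ εᴵ Γᴵ P_μ`, up to the constant factor `i / 2κ`. -/
def dilatinoVariation (e : Spacetime → Matrix (Fin 3) (Fin 3) ℝ)
    (P : Fin 3 → Spacetime → SpinIdx → ℝ) (ε : Spacetime → SusyParam)
    (B : CoSpinIdx) (α : Fin 2) (p : Spacetime) : ℝ :=
  ∑ μ, ∑ I, (gammaCurved e μ p *ᵥ ε p I) α * (gammaSO16 I *ᵥ P μ p) B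

theorem differentiableAt_comp {U : Set Spacetime} (hU : IsOpen U) {ε : Spacetime → SusyParam}
    (hε : DifferentiableOn ℝ ε U) {p : Spacetime} (hp : p ∈ U) (I : VecIdx) (α : Fin 2) :
    DifferentiableAt ℝ (fun q => ε q I α) p := by
  have h1 := (hε p hp).differentiableAt (hU.mem_nhds hp)
  exact differentiableAt_pi.1 (differentiableAt_pi.1 h1 I) α

/-- The real vector space of Killing spinors (preserved supersymmetries) on the open set `U`:
the supersymmetry parameters on `U` for which all fermion variations vanish.  The value `0`
off `U` is a convention that makes them functions on `U`. -/
def killingSpinors (U : Set Spacetime) (hU : IsOpen U)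
    (g e : Spacetime → Matrix (Fin 3) (Fin 3) ℝ)
    (P : Fin 3 → Spacetime → SpinIdx → ℝ) (Q : Fin 3 → Spacetime → SO16Alg) :
    Submodule ℝ (Spacetime → SusyParam) where
  carrier := {ε | DifferentiableOn ℝ ε U ∧ (∀ p ∉ U, ε p = 0) ∧
    (∀ p ∈ U, ∀ μ I α, gravitinoVariation g e Q ε μ I α p = 0) ∧
    (∀ p ∈ U, ∀ B α, dilatinoVariation e P ε B α p = 0)}
  add_mem' := by
    rintro ε η ⟨h1, h2, h3, h4⟩ ⟨k1, k2, k3, k4⟩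
    refine ⟨h1.add k1, fun p hp => by simp [h2 p hp, k2 p hp], fun p hp μ I α => ?_,
      fun p hp B α => ?_⟩
    · have h := h3 p hp μ I α
      have k := k3 p hp μ I α
      have hd : pd μ (fun q => (ε + η) q I α) p
          = pd μ (fun q => ε q I α) p + pd μ (fun q => η q I α) p := by
        simp only [pd, Pi.add_apply]
        rw [fderiv_fun_add (differentiableAt_comp hU h1 hp I α)
          (differentiableAt_comp hU k1 hp I α)]
        rfl
      simp only [gravitinoVariation] at h k ⊢
      rw [hd]
      simp only [Pi.add_apply, Matrix.mulVec_add, mul_add, Finset.sum_add_distrib]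
      linarith
    · have h := h4 p hp B α
      have k := k4 p hp B α
      simp only [dilatinoVariation] at h k ⊢
      simp only [Pi.add_apply, Matrix.mulVec_add, add_mul, Finset.sum_add_distrib]
      linarith
  zero_mem' := by
    refine ⟨differentiableOn_const 0, fun p _ => rfl, fun p _ μ I α => ?_, fun p _ B α => ?_⟩
    · simp [gravitinoVariation, pd]
    · simp [dilatinoVariation]
  smul_mem' := by
    rintro c ε ⟨h1, h2, h3, h4⟩
    refine ⟨h1.const_smul c, fun p hp => by simp [h2 p hp], fun p hp μ I α => ?_,
      fun p hp B α => ?_⟩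
    · have h := h3 p hp μ I α
      have hd : pd μ (fun q => (c • ε) q I α) p = c * pd μ (fun q => ε q I α) p := by
        simp only [pd, Pi.smul_apply, smul_eq_mul]
        rw [fderiv_const_mul (differentiableAt_comp hU h1 hp I α)]
        rfl
      simp only [gravitinoVariation] at h ⊢
      rw [hd]
      simp only [Pi.smul_apply, Matrix.mulVec_smul, smul_eq_mul, mul_left_comm _ c,
        ← Finset.mul_sum]
      linear_combination c * h
    · have h := h4 p hp B α
      simp only [dilatinoVariation] at h ⊢
      simp only [Pi.smul_apply, Matrix.mulVec_smul, smul_eq_mul, mul_assoc, ← Finset.mul_sum]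
      simp only [h, mul_zero]

/-! ### The null class -/

/-- The metric `ds² = -2 du dv - 2 ω(v,x) dv dx + h(v,x) dx²`; here `om` stands for `ω`. -/
def nullMetric (om h : ℝ → ℝ → ℝ) (p : Spacetime) : Matrix (Fin 3) (Fin 3) ℝ :=
  !![0, -1, 0; -1, 0, -om (p 1) (p 2); 0, -om (p 1) (p 2), h (p 1) (p 2)]

/-- `∂_v F` for a function `F (v, x)`. -/
def dv (F : ℝ → ℝ → ℝ) (v x : ℝ) : ℝ := deriv (fun s => F s x) v

/-- `∂_x F` for a function `F (v, x)`. -/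
def dx (F : ℝ → ℝ → ℝ) (v x : ℝ) : ℝ := deriv (fun s => F v s) x

/-- The values of `(v, x)` on the patch `U`. -/
def vxDomain (U : Set Spacetime) : Set (ℝ × ℝ) := (fun p => (p 1, p 2)) '' U

/-- A field configuration of the null class (pp-waves) on `U`: the metric is
`nullMetric om h`, and the scalars depend only on `v`. -/
structure IsNullClass (U : Set Spacetime) (om h : ℝ → ℝ → ℝ) (V : Spacetime → E8Group)
    (P : Fin 3 → Spacetime → SpinIdx → ℝ) (Q : Fin 3 → Spacetime → SO16Alg) : Prop where
  smooth_om : ContDiffOn ℝ ∞ (fun y : ℝ × ℝ => om y.1 y.2) (vxDomain U)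
  smooth_h : ContDiffOn ℝ ∞ (fun y : ℝ × ℝ => h y.1 y.2) (vxDomain U)
  h_pos : ∀ p ∈ U, 0 < h (p 1) (p 2)
  scalars : IsScalarConfiguration U V P Q
  scalars_v : ∀ p ∈ U, ∀ q ∈ U, p 1 = q 1 → V p = V q

/-- The relation
`((∂_v h)² + 2 ∂_x h ∂_v ω - 2 h (2 ∂_x ∂_v ω + ∂_v² h)) / (4 h²) = P_vᴬ(v) P_vᴬ(v)`
at the point `(v, x)`. -/
def NullEinstein (om h : ℝ → ℝ → ℝ) (Pv : ℝ → SpinIdx → ℝ) (v x : ℝ) : Prop :=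
  ((dv h v x) ^ 2 + 2 * dx h v x * dv om v x
      - 2 * h v x * (2 * dx (dv om) v x + dv (dv h) v x)) / (4 * h v x ^ 2)
    = Pv v ⬝ᵥ Pv v

/-- The equation
`-ω + ∂_x f + c ∂_v ω - h ∂_v² f / ∂_v ω + h ∂_v f ∂_v² ω / (∂_v ω)² = 0`
for `f (v, x)` and the constant `c`, at the point `(v, x)`. -/
def AuxiliaryEquation (om h f : ℝ → ℝ → ℝ) (c v x : ℝ) : Prop :=
  -om v x + dx f v x + c * dv om v x - h v x * (dv (dv f) v x / dv om v x)
    + h v x * (dv f v x * dv (dv om) v x / (dv om v x) ^ 2) = 0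

/-- The equation `h₀'' + h₀ P_vᴬ(v) P_vᴬ(v) = 0` at `v`. -/
def RosenEquation (h₀ : ℝ → ℝ) (Pv : ℝ → SpinIdx → ℝ) (v : ℝ) : Prop :=
  deriv (deriv h₀) v + h₀ v * (Pv v ⬝ᵥ Pv v) = 0

/-- The Jacobian matrix `∂_μ Ψ^ρ`, with row index `ρ` and column index `μ`. -/
def jacobian (Ψ : Spacetime → Spacetime) (p : Spacetime) : Matrix (Fin 3) (Fin 3) ℝ :=
  Matrix.of fun ρ μ => pd μ (fun q => Ψ q ρ) p

/-- The smooth coordinate transformation `Ψ` (a diffeomorphism of open sets) brings the metric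
`g` on its source to the metric `g'` in the new coordinates. -/
structure BringsMetricTo (Ψ : OpenPartialHomeomorph Spacetime Spacetime)
    (g g' : Spacetime → Matrix (Fin 3) (Fin 3) ℝ) : Prop where
  smooth : ContDiffOn ℝ ∞ Ψ Ψ.source
  smooth_symm : ContDiffOn ℝ ∞ Ψ.symm Ψ.target
  pullback : ∀ p ∈ Ψ.source, (jacobian Ψ p)ᵀ * g' (Ψ p) * jacobian Ψ p = g p

end

end MaxSugra

open MaxSugra

/-! Reduction. The scalars enter only through the Maurer-Cartan form `V⁻¹ ∂_μ V`. The adjoint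
representation of `𝔢₈₍₈₎` is faithful (`eq_of_e8Bracket_eq`), so a `V` that is constant along `u`
and `x` has a form with a single component, along `v`, and this component is a function of `v`. The
null metric has `Γ^v_{μν} = 0`, `g^{vv} = g^{xv} = 0` and only `R_vv` as a possibly non-zero Ricci
component. Hence every term of the scalar equation vanishes and the Einstein equation is a single
scalar equation (`fieldEquations_null_iff`).

Supersymmetry. The vector `∂_u` is null and parallel. In three dimensions a null vector is, up to
sign, the square of a real two-component spinor `ξ`. On a convex set the square root can be taken
globally, and `ξ` is parallel because `∂_u` is (`exists_parallel_spinor`). The matrix `γ^v` has rank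
one and kernel spanned by `ξ`. If `R' = -Q_v R`, then `(R(v) c)ᴵ ξ` is a Killing spinor for every `c
∈ ℝ¹⁶`, which gives dimension at least 16. Conversely, a Killing spinor is determined by its value
at one point. Where `P_v ≠ 0` the vectors `Γᴵ P_v` are orthogonal and non-zero, so the dilatino
equation forces `γ^v εᴵ = 0`. Each `εᴵ` is then a multiple of `ξ`, and the dimension is at most 16.

Rosen form. Seek new coordinates `u + S(v,x)`, `v`, `X(v,x)`. Comparing metrics expresses `dX` and
`dS` through `h₀`, `ω`, `h` and the single function `Z = h₀² ∂_v X`. Closedness of `dX` and `dS`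
prescribes `dZ`, and closedness of `dZ` is the Einstein equation as soon as `h₀'' = -h₀ P_v·P_v`. So
one solves this linear equation with `h₀ > 0` near `v₀` (Peano-Baker series) and integrates three
closed forms on a convex set (`exists_rosen_potentials`). Since `∂_x X > 0`, the coordinate map is
injective on the whole slab. -/

namespace MaxSugra

/-! ### Functions of two variables -/

section TwoVariables

variable {D : Set (ℝ × ℝ)} {F : ℝ → ℝ → ℝ}

/-- Smoothness of a function `F (v, x)` on a set of the plane. -/
def Smooth₂ (D : Set (ℝ × ℝ)) (F : ℝ → ℝ → ℝ) : Prop :=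
  ContDiffOn ℝ ∞ (fun y : ℝ × ℝ => F y.1 y.2) D

theorem Smooth₂.hasDerivAt_dv (hF : Smooth₂ D F) (hD : IsOpen D) {v x : ℝ} (hy : (v, x) ∈ D) :
    HasDerivAt (fun s => F s x) (dv F v x) v := by
  have h1 : DifferentiableAt ℝ (fun y : ℝ × ℝ => F y.1 y.2) (v, x) :=
    ((hF (v, x) hy).contDiffAt (hD.mem_nhds hy)).differentiableAt (by simp)
  have h2 : DifferentiableAt ℝ (fun s : ℝ => F s x) v :=
    h1.comp (f := fun s : ℝ => (s, x)) v (by fun_prop)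
  exact h2.hasDerivAt

theorem Smooth₂.hasDerivAt_dx (hF : Smooth₂ D F) (hD : IsOpen D) {v x : ℝ} (hy : (v, x) ∈ D) :
    HasDerivAt (fun s => F v s) (dx F v x) x := by
  have h1 : DifferentiableAt ℝ (fun y : ℝ × ℝ => F y.1 y.2) (v, x) :=
    ((hF (v, x) hy).contDiffAt (hD.mem_nhds hy)).differentiableAt (by simp)
  have h2 : DifferentiableAt ℝ (fun s : ℝ => F v s) x :=
    h1.comp (f := fun s : ℝ => (v, s)) x (by fun_prop)
  exact h2.hasDerivAt

theorem Smooth₂.hasFDerivAt (hF : Smooth₂ D F) (hD : IsOpen D) {y : ℝ × ℝ} (hy : y ∈ D) :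
    HasFDerivAt (fun y : ℝ × ℝ => F y.1 y.2)
      (dv F y.1 y.2 • ContinuousLinearMap.fst ℝ ℝ ℝ
        + dx F y.1 y.2 • ContinuousLinearMap.snd ℝ ℝ ℝ) y := by
  have h1 : DifferentiableAt ℝ (fun y : ℝ × ℝ => F y.1 y.2) y :=
    ((hF y hy).contDiffAt (hD.mem_nhds hy)).differentiableAt (by simp)
  have hv : fderiv ℝ (fun y : ℝ × ℝ => F y.1 y.2) y (1, 0) = dv F y.1 y.2 := by
    have h2 : HasDerivAt (fun s : ℝ => ((s, y.2) : ℝ × ℝ)) (1, 0) y.1 :=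
      (hasDerivAt_id _).prodMk (hasDerivAt_const _ _)
    exact (h1.hasFDerivAt.comp_hasDerivAt (f := fun s : ℝ => ((s, y.2) : ℝ × ℝ)) y.1
      h2).unique (hF.hasDerivAt_dv hD hy)
  have hx : fderiv ℝ (fun y : ℝ × ℝ => F y.1 y.2) y (0, 1) = dx F y.1 y.2 := by
    have h2 : HasDerivAt (fun s : ℝ => ((y.1, s) : ℝ × ℝ)) (0, 1) y.2 :=
      (hasDerivAt_const _ _).prodMk (hasDerivAt_id _)
    exact (h1.hasFDerivAt.comp_hasDerivAt (f := fun s : ℝ => ((y.1, s) : ℝ × ℝ)) y.2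
      h2).unique (hF.hasDerivAt_dx hD hy)
  convert h1.hasFDerivAt using 1
  ext <;> simp [hv, hx]

theorem Smooth₂.smooth_fderiv (hF : Smooth₂ D F) (hD : IsOpen D) :
    ContDiffOn ℝ ∞ (fderiv ℝ (fun y : ℝ × ℝ => F y.1 y.2)) D :=
  ((contDiffOn_infty_iff_fderiv_of_isOpen hD).1 hF).2

theorem Smooth₂.dv (hF : Smooth₂ D F) (hD : IsOpen D) : Smooth₂ D (dv F) := by
  have h := (hF.smooth_fderiv hD).clm_apply (contDiffOn_const (c := ((1, 0) : ℝ × ℝ)))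
  refine h.congr fun y hy => ?_
  rw [(hF.hasFDerivAt hD hy).fderiv]
  simp

theorem Smooth₂.dx (hF : Smooth₂ D F) (hD : IsOpen D) : Smooth₂ D (dx F) := by
  have h := (hF.smooth_fderiv hD).clm_apply (contDiffOn_const (c := ((0, 1) : ℝ × ℝ)))
  refine h.congr fun y hy => ?_
  rw [(hF.hasFDerivAt hD hy).fderiv]
  simp

theorem Smooth₂.fderiv_fderiv (hF : Smooth₂ D F) (hD : IsOpen D) {y : ℝ × ℝ} (hy : y ∈ D)
    (a b : ℝ × ℝ) :
    fderiv ℝ (fderiv ℝ (fun y : ℝ × ℝ => F y.1 y.2)) y a b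
      = (MaxSugra.dv (MaxSugra.dv F) y.1 y.2 * a.1 + MaxSugra.dx (MaxSugra.dv F) y.1 y.2 * a.2)
          * b.1
        + (MaxSugra.dv (MaxSugra.dx F) y.1 y.2 * a.1 + MaxSugra.dx (MaxSugra.dx F) y.1 y.2 * a.2)
          * b.2 := by
  have h1 := ((hF.dv hD).hasFDerivAt hD hy).smul_const (ContinuousLinearMap.fst ℝ ℝ ℝ)
  have h2 := ((hF.dx hD).hasFDerivAt hD hy).smul_const (ContinuousLinearMap.snd ℝ ℝ ℝ)
  have h3 : fderiv ℝ (fun y : ℝ × ℝ => F y.1 y.2) =ᶠ[nhds y] fun y =>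
      MaxSugra.dv F y.1 y.2 • ContinuousLinearMap.fst ℝ ℝ ℝ
        + MaxSugra.dx F y.1 y.2 • ContinuousLinearMap.snd ℝ ℝ ℝ := by
    filter_upwards [hD.mem_nhds hy] with z hz using (hF.hasFDerivAt hD hz).fderiv
  rw [h3.fderiv_eq, (h1.fun_add h2).fderiv]
  simp

theorem Smooth₂.dx_dv (hF : Smooth₂ D F) (hD : IsOpen D) {v x : ℝ} (hy : (v, x) ∈ D) :
    MaxSugra.dx (MaxSugra.dv F) v x = MaxSugra.dv (MaxSugra.dx F) v x := by
  have h : IsSymmSndFDerivAt ℝ (fun y : ℝ × ℝ => F y.1 y.2) (v, x) :=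
    ((hF _ hy).contDiffAt (hD.mem_nhds hy)).isSymmSndFDerivAt
      (by simpa using ENat.LEInfty.out (m := 2))
  have h1 := h.eq (0, 1) (1, 0)
  rw [hF.fderiv_fderiv hD hy, hF.fderiv_fderiv hD hy] at h1
  simpa using h1

/-- A closed 1-form `a dv + b dx` on a convex open set of the plane has a smooth potential. -/
theorem exists_smooth_potential (hD : IsOpen D) (hDc : Convex ℝ D) {a b : ℝ → ℝ → ℝ}
    (ha : Smooth₂ D a) (hb : Smooth₂ D b)
    (hab : ∀ v x, (v, x) ∈ D → dx a v x = dv b v x) :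
    ∃ S : ℝ → ℝ → ℝ, Smooth₂ D S ∧ ∀ v x, (v, x) ∈ D → dv S v x = a v x ∧ dx S v x = b v x := by
  set w : ℝ × ℝ → ℝ × ℝ →L[ℝ] ℝ := fun y =>
    a y.1 y.2 • ContinuousLinearMap.fst ℝ ℝ ℝ + b y.1 y.2 • ContinuousLinearMap.snd ℝ ℝ ℝ with hw
  have hws : ContDiffOn ℝ ∞ w D := by
    refine ContDiffOn.add ?_ ?_
    · exact ContDiffOn.smul ha contDiffOn_const
    · exact ContDiffOn.smul hb contDiffOn_const
  have hwd : ∀ y ∈ D, ∀ p q, fderiv ℝ w y p q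
      = (dv a y.1 y.2 * p.1 + dx a y.1 y.2 * p.2) * q.1
        + (dv b y.1 y.2 * p.1 + dx b y.1 y.2 * p.2) * q.2 := by
    intro y hy p q
    have h1 := (ha.hasFDerivAt hD hy).smul_const (ContinuousLinearMap.fst ℝ ℝ ℝ)
    have h2 := (hb.hasFDerivAt hD hy).smul_const (ContinuousLinearMap.snd ℝ ℝ ℝ)
    rw [hw, (h1.fun_add h2).fderiv]
    simp
  obtain ⟨f, hf⟩ := hDc.exists_forall_hasFDerivAt_of_fderiv_symmetric hD
    (hws.differentiableOn (by simp)) (fun y hy p q => by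
      rw [hwd y hy, hwd y hy, hab y.1 y.2 hy]; ring)
  have hS : Smooth₂ D (fun v x => f (v, x)) := by
    refine (contDiffOn_infty_iff_fderiv_of_isOpen hD).2
      ⟨fun y hy => (hf y hy).differentiableAt.differentiableWithinAt, ?_⟩
    exact hws.congr fun y hy => (hf y hy).fderiv
  refine ⟨fun v x => f (v, x), hS, fun v x hy => ?_⟩
  have h1 := (hS.hasFDerivAt hD hy).unique (hf _ hy)
  constructor
  · simpa [w] using congrArg (fun L : ℝ × ℝ →L[ℝ] ℝ => L (1, 0)) h1
  · simpa [w] using congrArg (fun L : ℝ × ℝ →L[ℝ] ℝ => L (0, 1)) h1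

/-- The partial derivatives on spacetime of a function of `(v, x)`. -/
theorem Smooth₂.hasFDerivAt_spacetime (hF : Smooth₂ D F) (hD : IsOpen D) {p : Spacetime}
    (hp : (p 1, p 2) ∈ D) :
    HasFDerivAt (fun q : Spacetime => F (q 1) (q 2))
      (MaxSugra.dv F (p 1) (p 2) • ContinuousLinearMap.proj (R := ℝ) (φ := fun _ : Fin 3 => ℝ) 1
        + MaxSugra.dx F (p 1) (p 2) • ContinuousLinearMap.proj (R := ℝ) (φ := fun _ : Fin 3 => ℝ) 2)
      p := by
  have h1 : HasFDerivAt (fun q : Spacetime => ((q 1, q 2) : ℝ × ℝ))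
      ((ContinuousLinearMap.proj (R := ℝ) (φ := fun _ : Fin 3 => ℝ) 1).prod
        (ContinuousLinearMap.proj (R := ℝ) (φ := fun _ : Fin 3 => ℝ) 2)) p :=
    (hasFDerivAt_apply 1 p).prodMk (hasFDerivAt_apply 2 p)
  have h2 := (hF.hasFDerivAt hD hp).comp (f := fun q : Spacetime => ((q 1, q 2) : ℝ × ℝ)) p h1
  exact h2.congr_fderiv (by ext; simp)

theorem Smooth₂.pd (hF : Smooth₂ D F) (hD : IsOpen D) {p : Spacetime}
    (hp : (p 1, p 2) ∈ D) (μ : Fin 3) :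
    MaxSugra.pd μ (fun q => F (q 1) (q 2)) p
      = ![0, MaxSugra.dv F (p 1) (p 2), MaxSugra.dx F (p 1) (p 2)] μ := by
  rw [MaxSugra.pd, (hF.hasFDerivAt_spacetime hD hp).fderiv]
  fin_cases μ <;> simp

end TwoVariables

/-! ### Linear ordinary differential equations -/

section LinearODE

open intervalIntegral Set

variable {𝔸 : Type*} [NormedRing 𝔸] [NormedAlgebra ℝ 𝔸]

/-- The iterated integrals of the Peano-Baker series. -/
noncomputable def peanoBaker (A : ℝ → 𝔸) (t₀ : ℝ) : ℕ → ℝ → 𝔸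
  | 0 => fun _ => 1
  | n + 1 => fun t => ∫ s in t₀..t, A s * peanoBaker A t₀ n s

/-- The fundamental theorem of calculus. Continuity of the preceding term is a hypothesis because
the two facts are proved in alternation: continuity of all terms follows from this by induction. -/
theorem hasDerivAt_peanoBaker_of_continuousOn [CompleteSpace 𝔸] {A : ℝ → 𝔸} {J : Set ℝ}
    (hJ : IsOpen J) (hJc : J.OrdConnected) (hA : ContinuousOn A J) {t₀ : ℝ} (ht₀ : t₀ ∈ J) {n : ℕ}
    (hc : ContinuousOn (peanoBaker A t₀ n) J) {t : ℝ} (ht : t ∈ J) :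
    HasDerivAt (peanoBaker A t₀ (n + 1)) (A t * peanoBaker A t₀ n t) t := by
  have hcm : ContinuousOn (fun s => A s * peanoBaker A t₀ n s) J := hA.mul hc
  refine integral_hasDerivAt_right ?_ ?_ (hcm.continuousAt (hJ.mem_nhds ht))
  · exact (hcm.mono (hJc.uIcc_subset ht₀ ht)).intervalIntegrable
  · exact hcm.stronglyMeasurableAtFilter hJ t ht

theorem continuousOn_peanoBaker [CompleteSpace 𝔸] {A : ℝ → 𝔸} {J : Set ℝ} (hJ : IsOpen J)
    (hJc : J.OrdConnected) (hA : ContinuousOn A J) {t₀ : ℝ} (ht₀ : t₀ ∈ J) (n : ℕ) :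
    ContinuousOn (peanoBaker A t₀ n) J := by
  induction n with
  | zero => exact continuousOn_const
  | succ n ih =>
    exact fun t ht => (hasDerivAt_peanoBaker_of_continuousOn hJ hJc hA ht₀ ih
      ht).continuousAt.continuousWithinAt

/-- Integrating the bound `C * (C |s - t₀|)^n / n!` from `t₀` to `t` raises the exponent and the
factorial by one. The factor `‖1‖` stays since the norm of the unit is not assumed to be 1. -/
theorem norm_peanoBaker_le {A : ℝ → 𝔸} {I : Set ℝ} (hIc : I.OrdConnected)
    {t₀ : ℝ} (ht₀ : t₀ ∈ I) {C : ℝ} (hC : ∀ t ∈ I, ‖A t‖ ≤ C)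
    (n : ℕ) {t : ℝ} (ht : t ∈ I) :
    ‖peanoBaker A t₀ n t‖ ≤ ‖(1 : 𝔸)‖ * (C * |t - t₀|) ^ n / n.factorial := by
  have hC0 : 0 ≤ C := (norm_nonneg _).trans (hC t₀ ht₀)
  induction n generalizing t with
  | zero => simp [peanoBaker]
  | succ n ih =>
    have hsub : Set.uIoc t₀ t ⊆ I := uIoc_subset_uIcc.trans (hIc.uIcc_subset ht₀ ht)
    calc ‖peanoBaker A t₀ (n + 1) t‖
        ≤ |∫ s in t₀..t, C * (‖(1 : 𝔸)‖ * (C * |s - t₀|) ^ n / n.factorial)| := by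
          refine intervalIntegral.norm_integral_le_abs_of_norm_le ?_ ?_
          · refine (MeasureTheory.ae_restrict_iff' measurableSet_uIoc).2 (.of_forall fun s hs => ?_)
            exact (norm_mul_le _ _).trans (mul_le_mul (hC s (hsub hs)) (ih (hsub hs))
              (norm_nonneg _) hC0)
          · exact Continuous.intervalIntegrable (by fun_prop) _ _
      _ = |∫ s in t₀..t, (‖(1 : 𝔸)‖ * C ^ (n + 1) / n.factorial) * |s - t₀| ^ n| := by
          congr 2; ext s; rw [mul_pow]; ring
      _ = (‖(1 : 𝔸)‖ * C ^ (n + 1) / n.factorial) * |∫ s in t₀..t, |s - t₀| ^ n| := by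
          rw [intervalIntegral.integral_const_mul, abs_mul, abs_of_nonneg (by positivity)]
      _ = ‖(1 : 𝔸)‖ * (C * |t - t₀|) ^ (n + 1) / (n + 1).factorial := by
          rw [abs_intervalIntegral_eq, integral_pow_abs_sub_uIoc, abs_of_nonneg (by positivity),
            Nat.factorial_succ]
          push_cast
          field_simp
          ring

/-- A linear differential equation `Y' = A Y` on an open interval has a global solution. -/
theorem exists_fundamental_solution [CompleteSpace 𝔸] {A : ℝ → 𝔸} {J : Set ℝ} (hJ : IsOpen J)
    (hJc : J.OrdConnected) (hA : ContinuousOn A J) {t₀ : ℝ} (ht₀ : t₀ ∈ J) :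
    ∃ Y : ℝ → 𝔸, Y t₀ = 1 ∧ ∀ t ∈ J, HasDerivAt Y (A t * Y t) t := by
  -- The term of order 0 is split off, so every remaining summand vanishes at `t₀`. This gives the
  -- initial value and also the point of convergence that termwise differentiation requires.
  refine ⟨fun t => 1 + ∑' n, peanoBaker A t₀ (n + 1) t, ?_, fun t ht => ?_⟩
  · simp [peanoBaker]
  -- `A` may be unbounded on `J`; a compact interval in `J` with `t` and `t₀` in its interior
  -- suffices for the derivative at `t`.
  obtain ⟨a, b, hab, hsub, ht, ht₀'⟩ : ∃ a b, a ≤ b ∧ Icc a b ⊆ J ∧ t ∈ Ioo a b ∧ t₀ ∈ Ioo a b := by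
    have h1 : min t t₀ ∈ J := by rcases min_choice t t₀ with h | h <;> rwa [h]
    have h2 : max t t₀ ∈ J := by rcases max_choice t t₀ with h | h <;> rwa [h]
    obtain ⟨ε, hε, h3⟩ := Metric.isOpen_iff.1 hJ _ h1
    obtain ⟨ε', hε', h4⟩ := Metric.isOpen_iff.1 hJ _ h2
    have h5 : min t t₀ - ε / 2 ∈ J := h3 (by
      rw [Metric.mem_ball, Real.dist_eq, abs_lt]; constructor <;> linarith)
    have h6 : max t t₀ + ε' / 2 ∈ J := h4 (by
      rw [Metric.mem_ball, Real.dist_eq, abs_lt]; constructor <;> linarith)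
    refine ⟨_, _, ?_, hJc.out h5 h6, ⟨?_, ?_⟩, ⟨?_, ?_⟩⟩ <;>
      linarith [min_le_left t t₀, min_le_right t t₀, le_max_left t t₀, le_max_right t t₀]
  obtain ⟨C, hC⟩ := isCompact_Icc.exists_bound_of_continuousOn (hA.mono hsub)
  have hC0 : 0 ≤ C := (norm_nonneg _).trans (hC t (Ioo_subset_Icc_self ht))
  have hb : ∀ n, ∀ s ∈ Ioo a b, ‖peanoBaker A t₀ n s‖
      ≤ ‖(1 : 𝔸)‖ * (C * (b - a)) ^ n / n.factorial := by
    intro n s hs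
    refine (norm_peanoBaker_le ordConnected_Ioo ht₀'
      (fun t ht => hC t (Ioo_subset_Icc_self ht)) n hs).trans ?_
    have : |s - t₀| ≤ b - a := by
      rw [abs_le]; constructor <;> linarith [hs.1, hs.2, ht₀'.1, ht₀'.2]
    gcongr
  have hsum : Summable fun n : ℕ => ‖(1 : 𝔸)‖ * (C * (b - a)) ^ n / n.factorial := by
    simp_rw [mul_div_assoc]
    exact (Real.summable_pow_div_factorial _).mul_left _
  have hst : Summable fun n => peanoBaker A t₀ n t := .of_norm_bounded hsum fun n => hb n t ht
  have hd := hasDerivAt_tsum_of_isPreconnected (hsum.mul_left C) isOpen_Ioo isPreconnected_Ioo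
    (g := fun n s => peanoBaker A t₀ (n + 1) s) (g' := fun n s => A s * peanoBaker A t₀ n s)
    (fun n s hs => hasDerivAt_peanoBaker_of_continuousOn hJ hJc hA ht₀
      (continuousOn_peanoBaker hJ hJc hA ht₀ n) (hsub (Ioo_subset_Icc_self hs)))
    (fun n s hs => (norm_mul_le _ _).trans (mul_le_mul (hC s (Ioo_subset_Icc_self hs)) (hb n s hs)
      (norm_nonneg _) hC0)) ht₀' (by simp [peanoBaker, summable_zero]) ht
  refine (hd.const_add (1 : 𝔸)).congr_deriv ?_
  -- The differentiated series starts at order 0, which restores the term 1 split off above.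
  rw [hst.tsum_mul_left, hst.tsum_eq_zero_add]
  rfl

/-- A solution of a linear system on `[0, 1]` with vanishing initial value vanishes. -/
theorem linear_ode_eq_zero {ι : Type*} [Fintype ι] {φ : ℝ → ι → ℝ} {B : ℝ → ι → ι → ℝ}
    (hB : ∀ i j, ContinuousOn (fun t => B t i j) (Icc 0 1))
    (hφ : ∀ t ∈ Icc (0 : ℝ) 1, ∀ i, HasDerivAt (fun s => φ s i) (∑ j, B t i j * φ t j) t)
    (h0 : φ 0 = 0) : φ 1 = 0 := by
  have hbd : ∀ i j, ∃ C, ∀ t ∈ Icc (0 : ℝ) 1, ‖B t i j‖ ≤ C := fun i j =>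
    isCompact_Icc.exists_bound_of_continuousOn (hB i j)
  choose C hC using hbd
  have hC0 : ∀ i j, 0 ≤ C i j := fun i j => (norm_nonneg _).trans (hC i j 0 (by simp))
  have hd : ∀ t ∈ Icc (0 : ℝ) 1, HasDerivAt φ (fun i => ∑ j, B t i j * φ t j) t := fun t ht =>
    hasDerivAt_pi.2 (hφ t ht)
  -- Grönwall in the sup norm: the sum of the bounds of all entries dominates every row sum.
  refine eq_zero_of_abs_deriv_le_mul_abs_self_of_eq_zero_right (K := ∑ i, ∑ j, C i j)
    (a := 0) (b := 1) (f' := fun t i => ∑ j, B t i j * φ t j)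
    (fun t ht => (hd t ht).continuousAt.continuousWithinAt)
    (fun t ht => (hd t (Ico_subset_Icc_self ht)).hasDerivWithinAt) h0 ?_ 1 (by simp)
  intro t ht
  refine (pi_norm_le_iff_of_nonneg (by
    exact mul_nonneg (Finset.sum_nonneg fun i _ => Finset.sum_nonneg fun j _ => hC0 i j)
      (norm_nonneg _))).2 fun i => ?_
  calc ‖∑ j, B t i j * φ t j‖ ≤ ∑ j, C i j * ‖φ t‖ := by
        refine norm_sum_le_of_le _ fun j _ => ?_
        rw [norm_mul]
        exact mul_le_mul (hC i j t (Ico_subset_Icc_self ht)) (norm_le_pi_norm _ _) (norm_nonneg _)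
          (hC0 i j)
    _ = (∑ j, C i j) * ‖φ t‖ := by rw [Finset.sum_mul]
    _ ≤ _ := by
        refine mul_le_mul_of_nonneg_right ?_ (norm_nonneg _)
        exact Finset.single_le_sum (f := fun i => ∑ j, C i j)
          (fun i _ => Finset.sum_nonneg fun j _ => hC0 i j) (Finset.mem_univ i)

end LinearODE

/-! ### Square roots of complex functions -/

/-- A smooth nonvanishing complex function on a convex open set has a differentiable square
root. -/
theorem exists_sqrt_of_convex {E : Type*} [NormedAddCommGroup E] [NormedSpace ℝ E]
    {U : Set E} (hU : IsOpen U) (hUc : Convex ℝ U) (hUn : U.Nonempty) {w : E → ℂ}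
    (hw : ContDiffOn ℝ ∞ w U) (hw0 : ∀ p ∈ U, w p ≠ 0) :
    ∃ z : E → ℂ, DifferentiableOn ℝ z U ∧ ∀ p ∈ U, z p ^ 2 = w p := by
  have hwd : ∀ p ∈ U, HasFDerivAt w (fderiv ℝ w p) p := fun p hp =>
    (((hw p hp).contDiffAt (hU.mem_nhds hp)).differentiableAt (by simp)).hasFDerivAt
  have hw2 : ContDiffOn ℝ ∞ (fderiv ℝ w) U := ((contDiffOn_infty_iff_fderiv_of_isOpen hU).1 hw).2
  have hwdd : ∀ p ∈ U, HasFDerivAt (fderiv ℝ w) (fderiv ℝ (fderiv ℝ w) p) p := fun p hp =>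
    (((hw2 p hp).contDiffAt (hU.mem_nhds hp)).differentiableAt (by simp)).hasFDerivAt
  have hinv : ∀ p ∈ U, HasFDerivAt (fun q => (w q)⁻¹)
      ((ContinuousLinearMap.toSpanSingleton ℂ (-(w p ^ 2)⁻¹)).restrictScalars ℝ
        ∘L fderiv ℝ w p) p := fun p hp =>
    ((hasDerivAt_inv (hw0 p hp)).hasFDerivAt.restrictScalars ℝ).comp p (hwd p hp)
  -- The form `dw / w` is closed, because the second derivative of `w` and the term `dw ⊗ dw` are
  -- both symmetric. Its primitive `f` is a logarithm of `w` up to an additive constant.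
  have hform : DifferentiableOn ℝ (fun p => (w p)⁻¹ • fderiv ℝ w p) U := fun p hp =>
    ((hinv p hp).smul (hwdd p hp)).differentiableAt.differentiableWithinAt
  obtain ⟨f, hf⟩ := hUc.exists_forall_hasFDerivAt_of_fderiv_symmetric (𝕜 := ℝ) hU hform
    (fun p hp a b => by
      have hsymm : IsSymmSndFDerivAt ℝ w p :=
        ((hw p hp).contDiffAt (hU.mem_nhds hp)).isSymmSndFDerivAt
          (by simpa using ENat.LEInfty.out (m := 2))
      rw [((hinv p hp).fun_smul (hwdd p hp)).fderiv]
      simp [hsymm.eq a b]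
      ring)
  obtain ⟨p₀, hp₀⟩ := hUn
  have hconst : ∀ p ∈ U, Complex.exp (-f p) * w p = Complex.exp (-f p₀) * w p₀ := by
    have hder : ∀ p ∈ U, HasFDerivAt (fun q => Complex.exp (-f q) * w q) (0 : E →L[ℝ] ℂ) p := by
      intro p hp
      have h1 := ((hf p hp).neg.cexp).mul (hwd p hp)
      refine h1.congr_fderiv ?_
      ext v
      have := hw0 p hp
      simp
      field_simp
      ring
    intro p hp
    exact hUc.is_const_of_fderivWithin_eq_zero (𝕜 := ℝ)
      (fun q hq => (hder q hq).differentiableAt.differentiableWithinAt)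
      (fun q hq => by
        rw [fderivWithin_of_isOpen hU hq, (hder q hq).fderiv]) hp hp₀
  -- A square root of the constant `exp (-f) w` corrects the unknown constant in the logarithm.
  obtain ⟨c, hc⟩ := IsSquare.exists_sq (Complex.exp (-f p₀) * w p₀)
    (IsAlgClosed.exists_eq_mul_self _ |>.imp fun _ h => h)
  refine ⟨fun p => c * Complex.exp (f p / 2), fun p hp => ?_, fun p hp => ?_⟩
  · have h1 : HasFDerivAt (fun q => f q / 2) _ p := (hf p hp).mul_const (2⁻¹ : ℂ)
    exact ((h1.cexp).const_mul c).differentiableAt.differentiableWithinAt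
  · rw [mul_pow, ← hc, ← hconst p hp, ← Complex.exp_nat_mul, mul_right_comm, ← Complex.exp_add]
    have : -f p + ((2 : ℕ) : ℂ) * (f p / 2) = 0 := by push_cast; ring
    rw [this, Complex.exp_zero, one_mul]

/-! ### The Clifford algebra -/

section Clifford

open Matrix

theorem neg_kron {l m n p : Type*} (A : Matrix l m ℝ) (B : Matrix n p ℝ) :
    (-A) ⊗ₖ B = -(A ⊗ₖ B) := by
  ext; simp [Matrix.kroneckerMap_apply]

theorem kron_neg {l m n p : Type*} (A : Matrix l m ℝ) (B : Matrix n p ℝ) :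
    A ⊗ₖ (-B) = -(A ⊗ₖ B) := by
  ext; simp [Matrix.kroneckerMap_apply]

theorem transpose_kron {l m n p : Type*} (A : Matrix l m ℝ) (B : Matrix n p ℝ) :
    (A ⊗ₖ B)ᵀ = Aᵀ ⊗ₖ Bᵀ := by
  ext; simp [Matrix.kroneckerMap_apply]

theorem eps_transpose : epsᵀ = -eps := by
  ext i j; fin_cases i <;> fin_cases j <;> simp [eps]

theorem tauOne_transpose : tauOneᵀ = tauOne := by
  ext i j; fin_cases i <;> fin_cases j <;> simp [tauOne]

theorem tauThree_transpose : tauThreeᵀ = tauThree := by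
  ext i j; fin_cases i <;> fin_cases j <;> simp [tauThree]

theorem eps_mul_eps : eps * eps = -1 := by
  ext i j; fin_cases i <;> fin_cases j <;> simp [eps]

theorem tauOne_mul_tauOne : tauOne * tauOne = 1 := by
  ext i j; fin_cases i <;> fin_cases j <;> simp [tauOne]

theorem tauThree_mul_tauThree : tauThree * tauThree = 1 := by
  ext i j; fin_cases i <;> fin_cases j <;> simp [tauThree]

theorem eps_mul_tauOne : eps * tauOne = tauThree := by
  ext i j; fin_cases i <;> fin_cases j <;> simp [eps, tauOne, tauThree]

theorem tauOne_mul_eps : tauOne * eps = -tauThree := by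
  ext i j; fin_cases i <;> fin_cases j <;> simp [eps, tauOne, tauThree]

theorem eps_mul_tauThree : eps * tauThree = -tauOne := by
  ext i j; fin_cases i <;> fin_cases j <;> simp [eps, tauOne, tauThree]

theorem tauThree_mul_eps : tauThree * eps = tauOne := by
  ext i j; fin_cases i <;> fin_cases j <;> simp [eps, tauOne, tauThree]

theorem tauOne_mul_tauThree : tauOne * tauThree = -eps := by
  ext i j; fin_cases i <;> fin_cases j <;> simp [eps, tauOne, tauThree]

theorem tauThree_mul_tauOne : tauThree * tauOne = eps := by
  ext i j; fin_cases i <;> fin_cases j <;> simp [eps, tauOne, tauThree]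

/-- Each gamma matrix is a Kronecker product of factors `1`, `eps`, `tauOne`, `tauThree`, whose
products close up to sign. All 64 cases are thus decided factor by factor: the two summands cancel,
or each is the identity. -/
theorem gammaSO8_clifford (a b : Fin 8) :
    (gammaSO8 a)ᵀ * gammaSO8 b + (gammaSO8 b)ᵀ * gammaSO8 a = if a = b then 2 else 0 := by
  fin_cases a <;> fin_cases b <;>
    simp [gammaSO8, transpose_kron, ← mul_kronecker_mul, neg_kron, kron_neg, eps_transpose,
      tauOne_transpose, tauThree_transpose, eps_mul_eps, tauOne_mul_tauOne, tauThree_mul_tauThree,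
      eps_mul_tauOne, tauOne_mul_eps, eps_mul_tauThree, tauThree_mul_eps, tauOne_mul_tauThree,
      tauThree_mul_tauOne, one_add_one_eq_two]

theorem gammaSO8_clifford' (a b : Fin 8) :
    gammaSO8 a * (gammaSO8 b)ᵀ + gammaSO8 b * (gammaSO8 a)ᵀ = if a = b then 2 else 0 := by
  fin_cases a <;> fin_cases b <;>
    simp [gammaSO8, transpose_kron, ← mul_kronecker_mul, neg_kron, kron_neg, eps_transpose,
      tauOne_transpose, tauThree_transpose, eps_mul_eps, tauOne_mul_tauOne, tauThree_mul_tauThree,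
      eps_mul_tauOne, tauOne_mul_eps, eps_mul_tauThree, tauThree_mul_eps, tauOne_mul_tauThree,
      tauThree_mul_tauOne, one_add_one_eq_two]

theorem two_kron_one {m n : Type*} [DecidableEq m] [DecidableEq n] :
    (2 : Matrix m m ℝ) ⊗ₖ (1 : Matrix n n ℝ) = 2 := by
  rw [← one_add_one_eq_two, add_kronecker, one_kronecker_one, one_add_one_eq_two]

theorem one_kron_two {m n : Type*} [DecidableEq m] [DecidableEq n] :
    (1 : Matrix m m ℝ) ⊗ₖ (2 : Matrix n n ℝ) = 2 := by
  rw [← one_add_one_eq_two, kronecker_add, one_kronecker_one, one_add_one_eq_two]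

theorem fromBlocks_two {m n : Type*} [DecidableEq m] [DecidableEq n] :
    fromBlocks (2 : Matrix m m ℝ) 0 0 (2 : Matrix n n ℝ) = 2 := by
  have h := fromBlocks_add (1 : Matrix m m ℝ) 0 0 (1 : Matrix n n ℝ) 1 0 0 1
  rwa [fromBlocks_one, one_add_one_eq_two, one_add_one_eq_two, one_add_one_eq_two, add_zero,
    add_zero, eq_comm] at h

theorem two_mulVec {n : Type*} [Fintype n] [DecidableEq n] (P : n → ℝ) :
    (2 : Matrix n n ℝ) *ᵥ P = P + P := by
  rw [← one_add_one_eq_two, add_mulVec, one_mulVec]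

/-- The Clifford relations of the gamma matrices of `SO(16)`. -/
theorem gammaSO16_clifford (I J : VecIdx) :
    (gammaSO16 I)ᵀ * gammaSO16 J + (gammaSO16 J)ᵀ * gammaSO16 I = if I = J then 2 else 0 := by
  rcases I with a | a <;> rcases J with b | b
  · have h1 := gammaSO8_clifford a b
    have h2 := gammaSO8_clifford' a b
    simp only [gammaSO16, fromBlocks_transpose, fromBlocks_multiply, fromBlocks_add,
      transpose_kron, ← mul_kronecker_mul, transpose_transpose, transpose_one, transpose_zero,
      zero_mul, mul_zero, zero_add, add_zero, mul_one, ← add_kronecker, h1, h2, Sum.inl.injEq]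
    split_ifs <;> simp [two_kron_one, fromBlocks_two]
  · simp [gammaSO16, fromBlocks_transpose, fromBlocks_multiply, fromBlocks_add,
      transpose_kron, ← mul_kronecker_mul]
  · simp [gammaSO16, fromBlocks_transpose, fromBlocks_multiply, fromBlocks_add,
      transpose_kron, ← mul_kronecker_mul]
  · have h1 := gammaSO8_clifford a b
    have h2 := gammaSO8_clifford' a b
    simp only [gammaSO16, fromBlocks_transpose, fromBlocks_multiply, fromBlocks_add,
      transpose_kron, ← mul_kronecker_mul, transpose_transpose, transpose_one, transpose_zero,
      transpose_neg, neg_mul_neg,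
      zero_mul, mul_zero, zero_add, add_zero, mul_one, ← kronecker_add, h1, h2, Sum.inr.injEq]
    split_ifs <;> simp [one_kron_two, fromBlocks_two]

theorem gammaSO16_transpose_mul_self (I : VecIdx) : (gammaSO16 I)ᵀ * gammaSO16 I = 1 := by
  have h := gammaSO16_clifford I I
  rw [if_pos rfl, ← two_mul] at h
  have h2 : (2 : ℝ) • ((gammaSO16 I)ᵀ * gammaSO16 I) = (2 : ℝ) • 1 := by
    rw [two_smul, two_smul, ← two_mul, h, one_add_one_eq_two]
  exact smul_right_injective _ two_ne_zero h2

/-- If `εᴵ Γᴵ P = 0` and `P ≠ 0`, then `ε = 0`. -/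
theorem eq_zero_of_sum_gammaSO16_mulVec {P : SpinIdx → ℝ} (hP : P ≠ 0) {c : VecIdx → ℝ}
    (h : ∑ I, c I • (gammaSO16 I *ᵥ P) = 0) : c = 0 := by
  have hPP : P ⬝ᵥ P ≠ 0 := fun h0 => hP (dotProduct_self_eq_zero.1 h0)
  -- By the Clifford relations the vectors `Γᴵ P` are pairwise orthogonal with common squared length
  -- `P·P`, hence linearly independent.
  have horth : ∀ I J, (gammaSO16 I *ᵥ P) ⬝ᵥ (gammaSO16 J *ᵥ P) = if I = J then P ⬝ᵥ P else 0 := by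
    intro I J
    have h1 : ∀ I J : VecIdx, (gammaSO16 I *ᵥ P) ⬝ᵥ (gammaSO16 J *ᵥ P)
        = P ⬝ᵥ (((gammaSO16 I)ᵀ * gammaSO16 J) *ᵥ P) := by
      intro I J
      rw [← mulVec_mulVec, dotProduct_mulVec P, vecMul_transpose]
    have h2 : (gammaSO16 I *ᵥ P) ⬝ᵥ (gammaSO16 J *ᵥ P)
        + (gammaSO16 J *ᵥ P) ⬝ᵥ (gammaSO16 I *ᵥ P) = if I = J then 2 * (P ⬝ᵥ P) else 0 := by
      rw [h1, h1, ← dotProduct_add, ← add_mulVec, gammaSO16_clifford]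
      split_ifs
      · rw [two_mulVec, dotProduct_add]; ring
      · simp
    rw [dotProduct_comm (gammaSO16 J *ᵥ P)] at h2
    split_ifs at h2 ⊢ <;> linarith
  ext J
  have h1 : (gammaSO16 J *ᵥ P) ⬝ᵥ ∑ I, c I • (gammaSO16 I *ᵥ P) = c J * (P ⬝ᵥ P) := by
    rw [dotProduct_sum]
    simp [dotProduct_smul, horth]
  rw [h, dotProduct_zero] at h1
  exact (mul_eq_zero.1 h1.symm).resolve_right hPP

theorem gammaIJ_transpose (I J : VecIdx) : (gammaIJ I J)ᵀ = gammaIJ J I := by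
  simp [gammaIJ, transpose_sub, transpose_mul]

/-- For `I ≠ J` the Clifford relation turns `Γᴵᴶ` into `(Γᴵ)ᵀ Γᴶ`, a product of two orthogonal
matrices, with inverse `(Γᴶ)ᵀ Γᴵ`. -/
theorem gammaIJ_mulVec_eq_zero {I J : VecIdx} (hIJ : I ≠ J) {P : SpinIdx → ℝ}
    (h : gammaIJ I J *ᵥ P = 0) : P = 0 := by
  have h1 : gammaIJ I J = (gammaSO16 I)ᵀ * gammaSO16 J := by
    have h2 := gammaSO16_clifford I J
    rw [if_neg hIJ] at h2
    rw [gammaIJ, ← neg_eq_of_add_eq_zero_right h2, sub_neg_eq_add, ← two_smul ℝ, smul_smul]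
    norm_num
  have h3 : gammaSO16 I * (gammaSO16 I)ᵀ = 1 :=
    mul_eq_one_comm.1 (gammaSO16_transpose_mul_self I)
  have h4 : ((gammaSO16 J)ᵀ * gammaSO16 I * gammaIJ I J) *ᵥ P = 0 := by
    rw [← mulVec_mulVec, h, mulVec_zero]
  rwa [h1, Matrix.mul_assoc, ← Matrix.mul_assoc (gammaSO16 I), h3, Matrix.one_mul,
    gammaSO16_transpose_mul_self, one_mulVec] at h4

end Clifford

/-! ### The centre of `𝔢₈₍₈₎` -/

section Centre

open Matrix

theorem eq_zero_of_so16_commute {Q : SO16Alg} (h : ∀ Y : SO16Alg, ⁅Q, Y⁆ = 0) : Q = 0 := by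
  have hQt : (Q : Matrix VecIdx VecIdx ℝ)ᵀ = -(Q : Matrix VecIdx VecIdx ℝ) :=
    (LieAlgebra.Orthogonal.mem_so _ _ _).1 Q.2
  have hskew : ∀ I J, (Q : Matrix VecIdx VecIdx ℝ) J I = -(Q : Matrix VecIdx VecIdx ℝ) I J :=
    fun I J => congrFun (congrFun hQt I) J
  ext K I
  by_cases hKI : K = I
  · subst hKI
    have := hskew K K
    simp only [ZeroMemClass.coe_zero, Matrix.zero_apply]
    linarith
  -- With a third index `J`, the `(K, J)` entry of the commutator of `Q` with `E_IJ - E_JI` is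
  -- exactly `Q_KI`; the other three products have no entry there.
  obtain ⟨J, hJ⟩ : ∃ J : VecIdx, J ∉ ({K, I} : Finset VecIdx) := by
    by_contra hcon
    push Not at hcon
    have h1 : (Finset.univ : Finset VecIdx).card ≤ ({K, I} : Finset VecIdx).card :=
      Finset.card_le_card fun J _ => hcon J
    have h2 := Finset.card_le_two (a := K) (b := I)
    simp at h1
    omega
  simp only [Finset.mem_insert, Finset.mem_singleton, not_or] at hJ
  let Y : SO16Alg := ⟨Matrix.single I J 1 - Matrix.single J I 1, by
    rw [LieAlgebra.Orthogonal.mem_so]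
    simp [transpose_single]⟩
  have hc := congrArg (fun Z : SO16Alg => (Z : Matrix VecIdx VecIdx ℝ) K J) (h Y)
  simp only [LieSubalgebra.coe_bracket, Ring.lie_def, Y, ZeroMemClass.coe_zero, Matrix.zero_apply,
    Matrix.mul_sub, Matrix.sub_mul, Matrix.sub_apply] at hc
  rw [Matrix.mul_single_apply_same, Matrix.mul_single_apply_of_ne _ _ _ _ _ hJ.2,
    Matrix.single_mul_apply_of_ne _ _ _ _ _ hKI,
    Matrix.single_mul_apply_of_ne _ _ _ _ _ (Ne.symm hJ.1)] at hc
  simpa using hc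

/-- The adjoint representation of `𝔢₈₍₈₎` is faithful. -/
theorem eq_of_e8Bracket_eq {X X' : E8Alg} (h : ∀ y, e8Bracket X y = e8Bracket X' y) : X = X' := by
  -- Brackets with `(0, q)` see the non-compact part: one entry of the result pairs `q` with the
  -- image of `P` under an injective `Γᴵᴶ`.
  have hP : X.2 - X'.2 = 0 := by
    refine gammaIJ_mulVec_eq_zero (I := Sum.inl 0) (J := Sum.inr 0) (by simp) ?_
    refine dotProduct_eq_zero _ fun q => ?_
    have h1 := congrArg (fun Z : E8Alg => (Z.1 : Matrix VecIdx VecIdx ℝ) (Sum.inr 0) (Sum.inl 0))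
      (h (0, q))
    simp only [e8Bracket, lie_zero, zero_add, noncompactBracket, of_apply] at h1
    rw [← gammaIJ_transpose, mulVec_transpose, ← dotProduct_mulVec, sub_dotProduct]
    linarith
  -- Brackets with `(Y, 0)` see the compact part, because `𝔰𝔬(16)` has trivial centre.
  have hQ : X.1 - X'.1 = 0 := by
    refine eq_zero_of_so16_commute fun Y => ?_
    have h1 := congrArg Prod.fst (h (Y, 0))
    have h0 : ∀ p, noncompactBracket p 0 = 0 := fun p => by
      ext I J; simp [noncompactBracket]
    simp only [e8Bracket, h0, add_zero] at h1
    rw [sub_lie, h1, sub_self]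
  exact Prod.ext (sub_eq_zero.1 hQ) (sub_eq_zero.1 hP)

end Centre

/-! ### Geometry of the null metric -/

section Geometry

variable {D : Set (ℝ × ℝ)} {om h : ℝ → ℝ → ℝ}

theorem pd_congr {U : Set Spacetime} (hU : IsOpen U) {F G : Spacetime → ℝ}
    (hFG : ∀ p ∈ U, F p = G p) {p : Spacetime} (hp : p ∈ U) (μ : Fin 3) : pd μ F p = pd μ G p := by
  have h1 : F =ᶠ[nhds p] G := by filter_upwards [hU.mem_nhds hp] with q hq using hFG q hq
  rw [pd, pd, h1.fderiv_eq]

@[simp]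
theorem pd_const (c : ℝ) (p : Spacetime) (μ : Fin 3) : pd μ (fun _ => c) p = 0 := by
  simp [pd]

@[simp]
theorem pd_neg (F : Spacetime → ℝ) (p : Spacetime) (μ : Fin 3) :
    pd μ (fun q => -F q) p = -pd μ F p := by
  simp [pd, fderiv_fun_neg]

/-- The inverse of the null metric. -/
noncomputable def nullMetricInv (om h : ℝ → ℝ → ℝ) (p : Spacetime) : Matrix (Fin 3) (Fin 3) ℝ :=
  !![om (p 1) (p 2) ^ 2 / h (p 1) (p 2), -1, -(om (p 1) (p 2) / h (p 1) (p 2));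
    -1, 0, 0;
    -(om (p 1) (p 2) / h (p 1) (p 2)), 0, 1 / h (p 1) (p 2)]

theorem nullMetric_mul_inv {p : Spacetime} (hp : h (p 1) (p 2) ≠ 0) :
    nullMetric om h p * nullMetricInv om h p = 1 := by
  ext i j
  fin_cases i <;> fin_cases j <;>
    simp [nullMetric, nullMetricInv, Matrix.mul_apply, Fin.sum_univ_three] <;> field_simp <;> ring

theorem inv_nullMetric {p : Spacetime} (hp : h (p 1) (p 2) ≠ 0) :
    (nullMetric om h p)⁻¹ = nullMetricInv om h p :=
  Matrix.inv_eq_right_inv (nullMetric_mul_inv hp)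

/-- The Christoffel symbols `Γˣ_{μν}` of the null metric. -/
noncomputable def nullChristoffelX (om h : ℝ → ℝ → ℝ) (v x : ℝ) : Matrix (Fin 3) (Fin 3) ℝ :=
  !![0, 0, 0;
    0, -(dv om v x / h v x), dv h v x / (2 * h v x);
    0, dv h v x / (2 * h v x), dx h v x / (2 * h v x)]

/-- The Christoffel symbols `Γᵘ_{μν}` of the null metric. -/
noncomputable def nullChristoffelU (om h : ℝ → ℝ → ℝ) (v x : ℝ) : Matrix (Fin 3) (Fin 3) ℝ :=
  !![0, 0, 0;
    0, om v x * dv om v x / h v x, -(om v x * dv h v x / (2 * h v x));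
    0, -(om v x * dv h v x / (2 * h v x)),
      dx om v x + dv h v x / 2 - om v x * dx h v x / (2 * h v x)]

/-- The Christoffel symbols `Γ^ρ_{μν}` of the null metric. -/
noncomputable def nullChristoffel (om h : ℝ → ℝ → ℝ) (ρ μ ν : Fin 3) (v x : ℝ) : ℝ :=
  ![nullChristoffelU om h v x, 0, nullChristoffelX om h v x] ρ μ ν

theorem pd_nullMetric (hD : IsOpen D) (hom : Smooth₂ D om) (hh : Smooth₂ D h) {p : Spacetime}
    (hp : (p 1, p 2) ∈ D) (μ i j : Fin 3) :
    pd μ (fun q => nullMetric om h q i j) p =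
      !![0, 0, 0;
        0, 0, -![0, dv om (p 1) (p 2), dx om (p 1) (p 2)] μ;
        0, -![0, dv om (p 1) (p 2), dx om (p 1) (p 2)] μ,
          ![0, dv h (p 1) (p 2), dx h (p 1) (p 2)] μ] i j := by
  rw [← hom.pd hD hp μ, ← hh.pd hD hp μ]
  fin_cases i <;> fin_cases j <;> simp [nullMetric]

theorem christoffel_nullMetric (hD : IsOpen D) (hom : Smooth₂ D om) (hh : Smooth₂ D h)
    {p : Spacetime} (hp : (p 1, p 2) ∈ D) (hp0 : h (p 1) (p 2) ≠ 0) (ρ μ ν : Fin 3) :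
    christoffel (nullMetric om h) ρ μ ν p = nullChristoffel om h ρ μ ν (p 1) (p 2) := by
  simp only [christoffel, inv_nullMetric hp0, pd_nullMetric hD hom hh hp]
  fin_cases ρ <;> fin_cases μ <;> fin_cases ν <;>
    simp [nullMetricInv, nullChristoffel, nullChristoffelX, nullChristoffelU,
      Fin.sum_univ_three] <;> field_simp <;> ring

theorem Smooth₂.div {F G : ℝ → ℝ → ℝ} (hF : Smooth₂ D F) (hG : Smooth₂ D G)
    (h0 : ∀ v x, (v, x) ∈ D → G v x ≠ 0) : Smooth₂ D (fun v x => F v x / G v x) :=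
  ContDiffOn.div hF hG fun y hy => h0 y.1 y.2 hy

theorem Smooth₂.mul {F G : ℝ → ℝ → ℝ} (hF : Smooth₂ D F) (hG : Smooth₂ D G) :
    Smooth₂ D (fun v x => F v x * G v x) :=
  ContDiffOn.mul hF hG

theorem Smooth₂.neg {F : ℝ → ℝ → ℝ} (hF : Smooth₂ D F) : Smooth₂ D (fun v x => -F v x) :=
  ContDiffOn.neg hF

theorem Smooth₂.add {F G : ℝ → ℝ → ℝ} (hF : Smooth₂ D F) (hG : Smooth₂ D G) :
    Smooth₂ D (fun v x => F v x + G v x) :=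
  ContDiffOn.add hF hG

theorem Smooth₂.sub {F G : ℝ → ℝ → ℝ} (hF : Smooth₂ D F) (hG : Smooth₂ D G) :
    Smooth₂ D (fun v x => F v x - G v x) :=
  ContDiffOn.sub hF hG

theorem smooth₂_const (c : ℝ) : Smooth₂ D (fun _ _ => c) := contDiffOn_const

theorem smooth_nullChristoffel (hD : IsOpen D) (hom : Smooth₂ D om) (hh : Smooth₂ D h)
    (h0 : ∀ v x, (v, x) ∈ D → h v x ≠ 0) (ρ μ ν : Fin 3) :
    Smooth₂ D (nullChristoffel om h ρ μ ν) := by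
  have h2 : Smooth₂ D (fun v x => 2 * h v x) := (smooth₂_const 2).mul hh
  have h20 : ∀ v x, (v, x) ∈ D → 2 * h v x ≠ 0 := fun v x hy => mul_ne_zero two_ne_zero (h0 v x hy)
  have c0 := smooth₂_const (D := D) 0
  have c1 := ((hom.dv hD).div hh h0).neg
  have c2 := (hh.dv hD).div h2 h20
  have c3 := (hh.dx hD).div h2 h20
  have c4 := (hom.mul (hom.dv hD)).div hh h0
  have c5 := ((hom.mul (hh.dv hD)).div h2 h20).neg
  have c6 := ((hom.dx hD).add ((hh.dv hD).div (smooth₂_const 2)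
    (fun _ _ _ => two_ne_zero))).sub ((hom.mul (hh.dx hD)).div h2 h20)
  fin_cases ρ <;> fin_cases μ <;> fin_cases ν <;> first
    | exact c0 | exact c1 | exact c2 | exact c3 | exact c4 | exact c5 | exact c6

theorem pd_christoffel_nullMetric (hD : IsOpen D) (hom : Smooth₂ D om) (hh : Smooth₂ D h)
    (h0 : ∀ v x, (v, x) ∈ D → h v x ≠ 0) {p : Spacetime} (hp : (p 1, p 2) ∈ D)
    (σ ρ μ ν : Fin 3) :
    pd σ (christoffel (nullMetric om h) ρ μ ν) p
      = ![0, dv (nullChristoffel om h ρ μ ν) (p 1) (p 2),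
          dx (nullChristoffel om h ρ μ ν) (p 1) (p 2)] σ := by
  rw [← (smooth_nullChristoffel hD hom hh h0 ρ μ ν).pd hD hp σ]
  have hO : IsOpen {q : Spacetime | (q 1, q 2) ∈ D} :=
    hD.preimage (f := fun q : Spacetime => (q 1, q 2)) (by fun_prop)
  exact pd_congr hO (fun q hq => christoffel_nullMetric hD hom hh hq (h0 _ _ hq) ρ μ ν) hp σ

/-- The Ricci tensor of the null metric. -/
theorem ricci_nullMetric (hD : IsOpen D) (hom : Smooth₂ D om) (hh : Smooth₂ D h)
    (h0 : ∀ v x, (v, x) ∈ D → h v x ≠ 0) {p : Spacetime} (hp : (p 1, p 2) ∈ D) (μ ν : Fin 3) :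
    ricci (nullMetric om h) μ ν p
      = if μ = 1 ∧ ν = 1 then
        ((dv h (p 1) (p 2)) ^ 2 + 2 * dx h (p 1) (p 2) * dv om (p 1) (p 2)
          - 2 * h (p 1) (p 2) * (2 * dx (dv om) (p 1) (p 2) + dv (dv h) (p 1) (p 2)))
          / (4 * h (p 1) (p 2) ^ 2) else 0 := by
  have hp0 := h0 _ _ hp
  simp only [ricci, christoffel_nullMetric hD hom hh hp hp0,
    pd_christoffel_nullMetric hD hom hh h0 hp]
  generalize p 1 = v, p 2 = x at *
  -- All symbols with upper index `v` or a lower index `u` vanish identically, and with them their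
  -- derivatives.
  have hz : ∀ ρ μ ν, (∀ v x, nullChristoffel om h ρ μ ν v x = 0) →
      dv (nullChristoffel om h ρ μ ν) v x = 0 ∧ dx (nullChristoffel om h ρ μ ν) v x = 0 := by
    intro ρ μ ν hz
    simp [dv, dx, hz]
  have zv : ∀ μ ν, dv (nullChristoffel om h 1 μ ν) v x = 0 := fun μ ν =>
    (hz 1 μ ν fun _ _ => rfl).1
  have zvx : ∀ μ ν, dx (nullChristoffel om h 1 μ ν) v x = 0 := fun μ ν =>
    (hz 1 μ ν fun _ _ => rfl).2
  have zu0 : ∀ ρ μ, dv (nullChristoffel om h ρ μ 0) v x = 0 := fun ρ μ =>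
    (hz ρ μ 0 fun _ _ => by fin_cases ρ <;> fin_cases μ <;> rfl).1
  have zu0x : ∀ ρ μ, dx (nullChristoffel om h ρ μ 0) v x = 0 := fun ρ μ =>
    (hz ρ μ 0 fun _ _ => by fin_cases ρ <;> fin_cases μ <;> rfl).2
  have z0u : ∀ ρ μ, dv (nullChristoffel om h ρ 0 μ) v x = 0 := fun ρ μ =>
    (hz ρ 0 μ fun _ _ => by fin_cases ρ <;> fin_cases μ <;> rfl).1
  have z0ux : ∀ ρ μ, dx (nullChristoffel om h ρ 0 μ) v x = 0 := fun ρ μ =>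
    (hz ρ 0 μ fun _ _ => by fin_cases ρ <;> fin_cases μ <;> rfl).2
  have hhv := hh.hasDerivAt_dv hD hp
  have hhx := hh.hasDerivAt_dx hD hp
  have hhvv := (hh.dv hD).hasDerivAt_dv hD hp
  have hhvx := (hh.dv hD).hasDerivAt_dx hD hp
  have hhxv := (hh.dx hD).hasDerivAt_dv hD hp
  have homvx := (hom.dv hD).hasDerivAt_dx hD hp
  have h20 : 2 * h v x ≠ 0 := mul_ne_zero two_ne_zero hp0
  have e1 : dx (nullChristoffel om h 2 1 1) v x
      = -((dx (dv om) v x * h v x - dv om v x * dx h v x) / h v x ^ 2) :=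
    (homvx.div hhx hp0).neg.deriv
  have e2 : dx (nullChristoffel om h 2 1 2) v x
      = (dx (dv h) v x * (2 * h v x) - dv h v x * (2 * dx h v x)) / (2 * h v x) ^ 2 :=
    (hhvx.div (hhx.const_mul 2) h20).deriv
  have e2' : dx (nullChristoffel om h 2 2 1) v x
      = (dx (dv h) v x * (2 * h v x) - dv h v x * (2 * dx h v x)) / (2 * h v x) ^ 2 := e2
  have e3 : dv (nullChristoffel om h 2 1 2) v x
      = (dv (dv h) v x * (2 * h v x) - dv h v x * (2 * dv h v x)) / (2 * h v x) ^ 2 :=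
    (hhvv.div (hhv.const_mul 2) h20).deriv
  -- The mixed derivative of `h` is put in the same order as in `e2'`, so that the two cancel in
  -- `R_xv`.
  have e4 : dv (nullChristoffel om h 2 2 2) v x
      = (dx (dv h) v x * (2 * h v x) - dx h v x * (2 * dv h v x)) / (2 * h v x) ^ 2 := by
    rw [hh.dx_dv hD hp]
    exact (hhxv.div (hhv.const_mul 2) h20).deriv
  fin_cases μ <;> fin_cases ν <;>
    simp [Fin.sum_univ_three, zv, zvx, zu0, zu0x, z0u, z0ux, e1, e2, e2', e3, e4] <;>
    simp [nullChristoffel, nullChristoffelX, nullChristoffelU] <;> field_simp <;> ring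

end Geometry

/-! ### Scalars that depend only on `v` -/

section Scalars

variable {U : Set Spacetime} {V : Spacetime → E8Group} {P : Fin 3 → Spacetime → SpinIdx → ℝ}
  {Q : Fin 3 → Spacetime → SO16Alg}

theorem hasDerivAt_pd {F : Spacetime → ℝ} {p : Spacetime} (hF : DifferentiableAt ℝ F p)
    (μ : Fin 3) :
    HasDerivAt (fun t : ℝ => F (p + t • Pi.single μ 1)) (pd μ F p) 0 := by
  have h1 : HasDerivAt (fun t : ℝ => p + t • (Pi.single μ 1 : Spacetime)) (Pi.single μ 1) 0 := by
    simpa using ((hasDerivAt_id (0 : ℝ)).smul_const (Pi.single μ 1 : Spacetime)).const_add p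
  have h2 : HasFDerivAt F (fderiv ℝ F p) (p + (0 : ℝ) • (Pi.single μ 1 : Spacetime)) := by
    simpa using hF.hasFDerivAt
  exact h2.comp_hasDerivAt 0 h1

theorem eventually_add_smul_mem (hU : IsOpen U) {p : Spacetime} (hp : p ∈ U) (w : Spacetime) :
    ∀ᶠ t : ℝ in nhds 0, p + t • w ∈ U := by
  have hc : ContinuousAt (fun t : ℝ => p + t • w) 0 := by fun_prop
  exact hc.eventually_mem (hU.mem_nhds (by simpa using hp))

/-- A function that depends only on `v` has no derivative in the directions `u` and `x`. -/
theorem pd_eq_zero_of_depends_v (hU : IsOpen U) {F : Spacetime → ℝ}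
    (hFv : ∀ p ∈ U, ∀ q ∈ U, p 1 = q 1 → F p = F q) {p : Spacetime} (hp : p ∈ U)
    {μ : Fin 3} (hμ : μ ≠ 1) : pd μ F p = 0 := by
  by_cases hF : DifferentiableAt ℝ F p
  · have h2 : (fun t : ℝ => F (p + t • Pi.single μ 1)) =ᶠ[nhds 0] fun _ => F p := by
      filter_upwards [eventually_add_smul_mem hU hp (Pi.single μ 1)] with t ht
      exact hFv _ ht _ hp (by simp [hμ.symm])
    exact ((hasDerivAt_const (0 : ℝ) (F p)).congr_of_eventuallyEq h2).unique
      (hasDerivAt_pd hF μ) |>.symm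
  -- Where `F` is not differentiable, `fderiv` is 0 by convention.
  · rw [pd, fderiv_zero_of_not_differentiableAt hF]; rfl

/-- Translation by `q - p` does not change `v`, so near `p` it leaves `F` invariant. No
differentiability is needed, since `fderiv` commutes with translations in any case. -/
theorem pd_eq_of_depends_v (hU : IsOpen U) {F : Spacetime → ℝ}
    (hFv : ∀ p ∈ U, ∀ q ∈ U, p 1 = q 1 → F p = F q) {p q : Spacetime} (hp : p ∈ U) (hq : q ∈ U)
    (hpq : p 1 = q 1) (μ : Fin 3) : pd μ F p = pd μ F q := by
  have h1 : (fun r => F (r + (q - p))) =ᶠ[nhds p] F := by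
    have hc : ContinuousAt (fun r : Spacetime => r + (q - p)) p := by fun_prop
    filter_upwards [hU.mem_nhds hp, hc.eventually_mem (hU.mem_nhds (by simpa using hq))]
      with r hr hr'
    exact hFv _ hr' _ hr (by simp [hpq])
  rw [pd, ← h1.fderiv_eq, fderiv_comp_add_right, add_sub_cancel, pd]

theorem e8_apply_injective (T : E8Group) {X Y : E8Alg}
    (hX : ∀ I J, (((T : E8Alg ≃ₗ[ℝ] E8Alg) X).1 : Matrix VecIdx VecIdx ℝ) I J
      = (((T : E8Alg ≃ₗ[ℝ] E8Alg) Y).1 : Matrix VecIdx VecIdx ℝ) I J)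
    (hY : ∀ A, ((T : E8Alg ≃ₗ[ℝ] E8Alg) X).2 A = ((T : E8Alg ≃ₗ[ℝ] E8Alg) Y).2 A) : X = Y :=
  (T : E8Alg ≃ₗ[ℝ] E8Alg).injective
    (Prod.ext (Subtype.ext (Matrix.ext hX)) (funext hY))

@[simp]
theorem spinRep_zero : spinRep 0 = 0 := by
  simp only [spinRep, Matrix.zero_apply, zero_smul, Finset.sum_const_zero, smul_zero]

theorem e8Bracket_zero_left (y : E8Alg) : e8Bracket 0 y = 0 := by
  have h0 : noncompactBracket 0 y.2 = 0 := by
    ext I J; simp [noncompactBracket]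
  simp only [e8Bracket, Prod.fst_zero, Prod.snd_zero, h0, zero_lie, add_zero,
    ZeroMemClass.coe_zero, spinRep_zero, Matrix.zero_mulVec, Matrix.mulVec_zero, sub_zero,
    Prod.mk_zero_zero]

/-- The derivative of `V y` along `u` or `x` is zero and equals `V [P_μ + Q_μ, y]`. Injectivity of
`V` and faithfulness of the adjoint representation remove `V` and `y`. -/
theorem maurerCartan_eq_zero (hU : IsOpen U) (hV : IsScalarConfiguration U V P Q)
    (hVv : ∀ p ∈ U, ∀ q ∈ U, p 1 = q 1 → V p = V q) {p : Spacetime} (hp : p ∈ U) {μ : Fin 3}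
    (hμ : μ ≠ 1) : P μ p = 0 ∧ Q μ p = 0 := by
  have h : ((Q μ p, P μ p) : E8Alg) = 0 := by
    refine eq_of_e8Bracket_eq fun y => e8_apply_injective (V p) (fun I J => ?_) fun A => ?_
    · rw [← hV.maurerCartan_compact p hp μ y I J, e8Bracket_zero_left, map_zero]
      exact pd_eq_zero_of_depends_v hU (fun a ha b hb hab => by rw [hVv a ha b hb hab]) hp hμ
    · rw [← hV.maurerCartan_noncompact p hp μ y A, e8Bracket_zero_left, map_zero]
      exact pd_eq_zero_of_depends_v hU (fun a ha b hb hab => by rw [hVv a ha b hb hab]) hp hμ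
  exact ⟨congrArg Prod.snd h, congrArg Prod.fst h⟩

theorem maurerCartan_eq_of_eq (hU : IsOpen U) (hV : IsScalarConfiguration U V P Q)
    (hVv : ∀ p ∈ U, ∀ q ∈ U, p 1 = q 1 → V p = V q) {p q : Spacetime} (hp : p ∈ U) (hq : q ∈ U)
    (hpq : p 1 = q 1) (μ : Fin 3) : P μ p = P μ q ∧ Q μ p = Q μ q := by
  have h : ((Q μ p, P μ p) : E8Alg) = (Q μ q, P μ q) := by
    refine eq_of_e8Bracket_eq fun y => e8_apply_injective (V p) (fun I J => ?_) fun A => ?_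
    · rw [← hV.maurerCartan_compact p hp μ y I J, hVv p hp q hq hpq,
        ← hV.maurerCartan_compact q hq μ y I J]
      exact pd_eq_of_depends_v hU (fun a ha b hb hab => by rw [hVv a ha b hb hab]) hp hq hpq μ
    · rw [← hV.maurerCartan_noncompact p hp μ y A, hVv p hp q hq hpq,
        ← hV.maurerCartan_noncompact q hq μ y A]
      exact pd_eq_of_depends_v hU (fun a ha b hb hab => by rw [hVv a ha b hb hab]) hp hq hpq μ
  exact ⟨congrArg Prod.snd h, congrArg Prod.fst h⟩

/-- The values of `v` on the patch `U`. -/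
def vDomain (U : Set Spacetime) : Set ℝ := (fun p => p 1) '' U

theorem isOpen_vDomain (hU : IsOpen U) : IsOpen (vDomain U) :=
  isOpenMap_eval (1 : Fin 3) U hU

theorem ordConnected_vDomain (hUc : Convex ℝ U) : (vDomain U).OrdConnected :=
  (hUc.linear_image (LinearMap.proj (R := ℝ) (φ := fun _ : Fin 3 => ℝ) 1)).ordConnected

theorem isOpen_vxDomain (hU : IsOpen U) : IsOpen (vxDomain U) := by
  rw [isOpen_iff_mem_nhds]
  rintro _ ⟨p, hp, rfl⟩
  have hc : ContinuousAt (fun y : ℝ × ℝ => (![p 0, y.1, y.2] : Spacetime)) (p 1, p 2) := by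
    refine continuousAt_pi.2 fun i => ?_
    fin_cases i
    · exact continuousAt_const
    · exact continuousAt_fst
    · exact continuousAt_snd
  have hpp : ![p 0, p 1, p 2] = p := by ext i; fin_cases i <;> rfl
  filter_upwards [hc.eventually_mem (hU.mem_nhds (by rw [hpp]; exact hp))] with y hy
  exact ⟨_, hy, rfl⟩

theorem convex_vxDomain (hUc : Convex ℝ U) : Convex ℝ (vxDomain U) :=
  hUc.linear_image ((LinearMap.proj (R := ℝ) (φ := fun _ : Fin 3 => ℝ) 1).prod
    (LinearMap.proj (R := ℝ) (φ := fun _ : Fin 3 => ℝ) 2))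

theorem mem_vxDomain {p : Spacetime} (hp : p ∈ U) : (p 1, p 2) ∈ vxDomain U := ⟨p, hp, rfl⟩

theorem exists_factor_v {α : Type*} [Inhabited α] {F : Spacetime → α}
    (hF : ∀ p ∈ U, ∀ q ∈ U, p 1 = q 1 → F p = F q) : ∃ G : ℝ → α, ∀ p ∈ U, F p = G (p 1) := by
  classical
  refine ⟨fun v => if hv : ∃ p ∈ U, p 1 = v then F hv.choose else default, fun p hp => ?_⟩
  have hv : ∃ q ∈ U, q 1 = p 1 := ⟨p, hp, rfl⟩
  simp only [dif_pos hv]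
  exact hF _ hp _ hv.choose_spec.1 hv.choose_spec.2.symm

/-- Locally `G` is the restriction of `F` to a line in the `v`-direction through a point of `U`. -/
theorem contDiffOn_of_factor_v (hU : IsOpen U) {F : Spacetime → ℝ} (hF : ContDiffOn ℝ ∞ F U)
    {G : ℝ → ℝ} (hG : ∀ p ∈ U, F p = G (p 1)) : ContDiffOn ℝ ∞ G (vDomain U) := by
  rintro _ ⟨p, hp, rfl⟩
  have hpp : p + (p 1 - p 1) • (Pi.single 1 1 : Spacetime) = p := by simp
  have hc : ContDiffAt ℝ ∞ (fun s : ℝ => p + (s - p 1) • (Pi.single 1 1 : Spacetime)) (p 1) := by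
    fun_prop
  have h1 : ContDiffAt ℝ ∞ (fun s : ℝ => F (p + (s - p 1) • (Pi.single 1 1 : Spacetime)))
      (p 1) := by
    refine ContDiffAt.comp (g := F) (p 1) ?_ hc
    rw [hpp]
    exact (hF p hp).contDiffAt (hU.mem_nhds hp)
  refine ContDiffAt.contDiffWithinAt (h1.congr_of_eventuallyEq ?_)
  filter_upwards [hc.continuousAt.eventually_mem (hU.mem_nhds (by rw [hpp]; exact hp))] with s hs
  rw [hG _ hs]
  simp

end Scalars

/-! ### Reduction of the field equations to the `vv` component -/

section FieldEquations

variable {U : Set Spacetime} {om h : ℝ → ℝ → ℝ} {P : Fin 3 → Spacetime → SpinIdx → ℝ}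
  {Q : Fin 3 → Spacetime → SO16Alg}

/-- The field equations of the null class amount to a single equation. -/
theorem fieldEquations_null_iff (hU : IsOpen U) (hom : Smooth₂ (vxDomain U) om)
    (hh : Smooth₂ (vxDomain U) h) (h0 : ∀ v x, (v, x) ∈ vxDomain U → h v x ≠ 0)
    (hPQ : ∀ p ∈ U, ∀ μ, μ ≠ 1 → P μ p = 0 ∧ Q μ p = 0) {Pv : ℝ → SpinIdx → ℝ}
    (hPv : ∀ p ∈ U, P 1 p = Pv (p 1)) :
    FieldEquations U (nullMetric om h) P Q ↔ ∀ p ∈ U, NullEinstein om h Pv (p 1) (p 2) := by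
  have hD := isOpen_vxDomain hU
  constructor
  · intro hF p hp
    have h1 := hF.einstein p hp 1 1
    rw [ricci_nullMetric hD hom hh h0 (mem_vxDomain hp), if_pos ⟨rfl, rfl⟩, hPv p hp] at h1
    exact h1
  · intro hE
    refine ⟨fun p hp μ ν => ?_, fun p hp A => ?_⟩
    · rw [ricci_nullMetric hD hom hh h0 (mem_vxDomain hp)]
      split_ifs with hμν
      · rw [hμν.1, hμν.2, hPv p hp]
        exact hE p hp
      · rcases not_and_or.1 hμν with hμ | hν
        · rw [(hPQ p hp μ hμ).1, zero_dotProduct]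
        · rw [(hPQ p hp ν hν).1, dotProduct_zero]
    -- The scalar equation holds term by term. The connection term drops out because `Γ^v = 0`; only
    -- `ν = v` carries a non-zero `P_ν`; and `g^{μv} ≠ 0` only for `μ = u`, where `∂_u P_v = 0` and
    -- `Q_u = 0`.
    · have hp0 := h0 _ _ (mem_vxDomain hp)
      have hd : ∀ μ ν, ν ≠ 1 → pd μ (fun q => P ν q A) p = 0 := by
        intro μ ν hν
        rw [pd_congr hU (G := fun _ => 0) (fun q hq => by rw [(hPQ q hq ν hν).1]; rfl) hp μ,
          pd_const]
      have hΓ : ∀ μ ν, ∑ ρ, christoffel (nullMetric om h) ρ μ ν p * P ρ p A = 0 := by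
        refine fun μ ν => Finset.sum_eq_zero fun ρ _ => ?_
        by_cases hρ : ρ = 1
        · rw [hρ, christoffel_nullMetric hD hom hh (mem_vxDomain hp) hp0]
          exact zero_mul _
        · rw [(hPQ p hp ρ hρ).1]
          exact mul_zero _
      refine Finset.sum_eq_zero fun μ _ => Finset.sum_eq_zero fun ν _ => ?_
      rw [hΓ, sub_zero]
      by_cases hν : ν = 1
      · rw [hν, inv_nullMetric hp0]
        by_cases hμ : μ = 0
        · have hd1 : pd μ (fun q => P 1 q A) p = 0 :=
            pd_eq_zero_of_depends_v hU (fun a ha b hb hab => by rw [hPv a ha, hPv b hb, hab]) hp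
              (by rw [hμ]; decide)
          rw [hd1, (hPQ p hp μ (by rw [hμ]; decide)).2, ZeroMemClass.coe_zero, spinRep_zero,
            Matrix.zero_mulVec, Pi.zero_apply, add_zero, mul_zero]
        · have hg : nullMetricInv om h p μ 1 = 0 := by
            fin_cases μ <;> first | exact absurd rfl hμ | rfl
          rw [hg, zero_mul]
      · rw [hd μ ν hν, (hPQ p hp ν hν).1, Matrix.mulVec_zero, Pi.zero_apply, add_zero, mul_zero]

end FieldEquations

/-! ### Vielbeine of the null metric -/

section Vielbein

open Matrix

theorem pd_add {F G : Spacetime → ℝ} {p : Spacetime} (hF : DifferentiableAt ℝ F p)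
    (hG : DifferentiableAt ℝ G p) (μ : Fin 3) :
    pd μ (fun q => F q + G q) p = pd μ F p + pd μ G p := by
  rw [pd, fderiv_fun_add hF hG]; rfl

theorem pd_sub {F G : Spacetime → ℝ} {p : Spacetime} (hF : DifferentiableAt ℝ F p)
    (hG : DifferentiableAt ℝ G p) (μ : Fin 3) :
    pd μ (fun q => F q - G q) p = pd μ F p - pd μ G p := by
  rw [pd, fderiv_fun_sub hF hG]; rfl

theorem pd_mul {F G : Spacetime → ℝ} {p : Spacetime} (hF : DifferentiableAt ℝ F p)
    (hG : DifferentiableAt ℝ G p) (μ : Fin 3) :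
    pd μ (fun q => F q * G q) p = pd μ F p * G p + F p * pd μ G p := by
  rw [pd, fderiv_fun_mul hF hG]
  simp only [_root_.add_apply, _root_.smul_apply, smul_eq_mul, pd]
  ring

theorem pd_sum {ι : Type*} {s : Finset ι} {F : ι → Spacetime → ℝ} {p : Spacetime}
    (hF : ∀ i ∈ s, DifferentiableAt ℝ (F i) p) (μ : Fin 3) :
    pd μ (fun q => ∑ i ∈ s, F i q) p = ∑ i ∈ s, pd μ (F i) p := by
  rw [pd, fderiv_fun_sum hF]
  simp [pd]

/-- The entrywise partial derivative of a matrix function. -/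
noncomputable def pdM (μ : Fin 3) (F : Spacetime → Matrix (Fin 3) (Fin 3) ℝ) (p : Spacetime) :
    Matrix (Fin 3) (Fin 3) ℝ :=
  Matrix.of fun i j => pd μ (fun q => F q i j) p

theorem pdM_mul {F G : Spacetime → Matrix (Fin 3) (Fin 3) ℝ} {p : Spacetime}
    (hF : ∀ i j, DifferentiableAt ℝ (fun q => F q i j) p)
    (hG : ∀ i j, DifferentiableAt ℝ (fun q => G q i j) p) (μ : Fin 3) :
    pdM μ (fun q => F q * G q) p = pdM μ F p * G p + F p * pdM μ G p := by
  ext i j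
  simp only [pdM, of_apply, mul_apply, Matrix.add_apply]
  rw [pd_sum (F := fun k q => F q i k * G q k j) (fun k _ => (hF i k).fun_mul (hG k j)),
    ← Finset.sum_add_distrib]
  exact Finset.sum_congr rfl fun k _ => pd_mul (hF i k) (hG k j) μ

theorem pdM_transpose (F : Spacetime → Matrix (Fin 3) (Fin 3) ℝ) (p : Spacetime) (μ : Fin 3) :
    pdM μ (fun q => (F q)ᵀ) p = (pdM μ F p)ᵀ := rfl

theorem pdM_congr {U : Set Spacetime} (hU : IsOpen U)
    {F G : Spacetime → Matrix (Fin 3) (Fin 3) ℝ} (hFG : ∀ p ∈ U, F p = G p) {p : Spacetime}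
    (hp : p ∈ U) (μ : Fin 3) : pdM μ F p = pdM μ G p := by
  ext i j
  exact pd_congr hU (fun q hq => by rw [hFG q hq]) hp μ

theorem mink_mul_mink : mink * mink = 1 := by
  rw [mink, diagonal_mul_diagonal, ← diagonal_one]
  congr 1
  ext i
  fin_cases i <;> simp

variable {U : Set Spacetime} {om h : ℝ → ℝ → ℝ} {e : Spacetime → Matrix (Fin 3) (Fin 3) ℝ}

theorem Smooth₂.comp_spacetime {F : ℝ → ℝ → ℝ} (hF : Smooth₂ (vxDomain U) F) :
    ContDiffOn ℝ ∞ (fun p : Spacetime => F (p 1) (p 2)) U :=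
  ContDiffOn.comp (g := fun y : ℝ × ℝ => F y.1 y.2) (f := fun p : Spacetime => (p 1, p 2)) hF
    (by fun_prop) fun _ hp => mem_vxDomain hp

theorem smooth_nullMetricInv (hom : Smooth₂ (vxDomain U) om) (hh : Smooth₂ (vxDomain U) h)
    (h0 : ∀ v x, (v, x) ∈ vxDomain U → h v x ≠ 0) (i j : Fin 3) :
    ContDiffOn ℝ ∞ (fun p => nullMetricInv om h p i j) U := by
  have c0 : ContDiffOn ℝ ∞ (fun _ : Spacetime => (0 : ℝ)) U := contDiffOn_const
  have c1 : ContDiffOn ℝ ∞ (fun _ : Spacetime => (-1 : ℝ)) U := contDiffOn_const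
  have hn : ∀ p ∈ U, h (p 1) (p 2) ≠ 0 := fun p hp => h0 _ _ (mem_vxDomain hp)
  have c2 : ContDiffOn ℝ ∞ (fun p : Spacetime => om (p 1) (p 2) ^ 2 / h (p 1) (p 2)) U :=
    (hom.comp_spacetime.pow 2).div hh.comp_spacetime hn
  have c3 : ContDiffOn ℝ ∞ (fun p : Spacetime => -(om (p 1) (p 2) / h (p 1) (p 2))) U :=
    (hom.comp_spacetime.div hh.comp_spacetime hn).neg
  have c4 : ContDiffOn ℝ ∞ (fun p : Spacetime => 1 / h (p 1) (p 2)) U :=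
    contDiffOn_const.div hh.comp_spacetime hn
  fin_cases i <;> fin_cases j <;> first
    | exact c0 | exact c1 | exact c2 | exact c3 | exact c4

/-- Orthonormality exhibits `g⁻¹ eᵀ η` as a left inverse of `e`, so invertibility of the vielbein
need not be part of its definition. -/
theorem inv_vielbein_mul (he : IsVielbein U (nullMetric om h) e)
    {p : Spacetime} (hp : p ∈ U) (hp0 : h (p 1) (p 2) ≠ 0) :
    nullMetricInv om h p * (e p)ᵀ * mink * e p = 1 := by
  rw [Matrix.mul_assoc, Matrix.mul_assoc, ← Matrix.mul_assoc _ mink, he.orthonormal p hp]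
  exact mul_eq_one_comm.1 (nullMetric_mul_inv hp0)

theorem invVielbein_eq (he : IsVielbein U (nullMetric om h) e)
    {p : Spacetime} (hp : p ∈ U) (hp0 : h (p 1) (p 2) ≠ 0) :
    invVielbein e p = nullMetricInv om h p * (e p)ᵀ := by
  rw [invVielbein, Matrix.inv_eq_left_inv (inv_vielbein_mul he hp hp0), Matrix.mul_assoc,
    mink_mul_mink, Matrix.mul_one]

theorem invVielbein_mul_mink_mul (he : IsVielbein U (nullMetric om h) e)
    {p : Spacetime} (hp : p ∈ U) (hp0 : h (p 1) (p 2) ≠ 0) :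
    invVielbein e p * mink * e p = 1 := by
  rw [invVielbein_eq he hp hp0, inv_vielbein_mul he hp hp0]

theorem nullMetricInv_transpose (p : Spacetime) :
    (nullMetricInv om h p)ᵀ = nullMetricInv om h p := by
  ext i j
  fin_cases i <;> fin_cases j <;> rfl

theorem invVielbein_mul_mink_mul_transpose (he : IsVielbein U (nullMetric om h) e)
    {p : Spacetime} (hp : p ∈ U) (hp0 : h (p 1) (p 2) ≠ 0) :
    invVielbein e p * (mink * (invVielbein e p)ᵀ) = nullMetricInv om h p := by
  have h1 := invVielbein_mul_mink_mul he hp hp0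
  nth_rewrite 2 [invVielbein_eq he hp hp0]
  rw [transpose_mul, transpose_transpose, nullMetricInv_transpose, ← Matrix.mul_assoc,
    ← Matrix.mul_assoc, h1, Matrix.one_mul]

theorem smooth_invVielbein (hom : Smooth₂ (vxDomain U) om)
    (hh : Smooth₂ (vxDomain U) h) (h0 : ∀ v x, (v, x) ∈ vxDomain U → h v x ≠ 0)
    (he : IsVielbein U (nullMetric om h) e) (i j : Fin 3) :
    ContDiffOn ℝ ∞ (fun p => invVielbein e p i j) U := by
  have h1 : ContDiffOn ℝ ∞ (fun p => ∑ l, nullMetricInv om h p i l * e p j l) U :=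
    ContDiffOn.sum fun l _ => (smooth_nullMetricInv hom hh h0 i l).mul (he.smooth j l)
  refine h1.congr fun p hp => ?_
  rw [invVielbein_eq he hp (h0 _ _ (mem_vxDomain hp))]
  rfl

/-- The matrix `(Γ_μ)^ρ_ν` of Christoffel symbols. -/
noncomputable def christoffelM (g : Spacetime → Matrix (Fin 3) (Fin 3) ℝ) (μ : Fin 3)
    (p : Spacetime) : Matrix (Fin 3) (Fin 3) ℝ :=
  Matrix.of fun ρ ν => christoffel g ρ μ ν p

/-- The matrix `ω_μ^{ab}` of the spin connection. -/
noncomputable def spinConnectionM (g e : Spacetime → Matrix (Fin 3) (Fin 3) ℝ) (μ : Fin 3)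
    (p : Spacetime) : Matrix (Fin 3) (Fin 3) ℝ :=
  Matrix.of fun a b => spinConnection g e μ a b p

theorem spinConnectionM_eq (g e : Spacetime → Matrix (Fin 3) (Fin 3) ℝ) (μ : Fin 3)
    (p : Spacetime) :
    spinConnectionM g e μ p
      = e p * (pdM μ (invVielbein e) p + christoffelM g μ p * invVielbein e p) := by
  ext a b
  simp [spinConnectionM, spinConnection, pdM, christoffelM, mul_apply]

/-- The Christoffel connection of the null metric is metric. -/
theorem pdM_nullMetricInv (hU : IsOpen U) (hom : Smooth₂ (vxDomain U) om)
    (hh : Smooth₂ (vxDomain U) h) (h0 : ∀ v x, (v, x) ∈ vxDomain U → h v x ≠ 0)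
    {p : Spacetime} (hp : p ∈ U) (μ : Fin 3) :
    pdM μ (nullMetricInv om h) p + christoffelM (nullMetric om h) μ p * nullMetricInv om h p
      + (christoffelM (nullMetric om h) μ p * nullMetricInv om h p)ᵀ = 0 := by
  have hD := isOpen_vxDomain hU
  have hp' := mem_vxDomain hp
  have hp0 := h0 _ _ hp'
  have hc : christoffelM (nullMetric om h) μ p
      = Matrix.of fun ρ ν => nullChristoffel om h ρ μ ν (p 1) (p 2) := by
    ext ρ ν
    exact christoffel_nullMetric hD hom hh hp' hp0 ρ μ ν
  have s1 : Smooth₂ (vxDomain U) (fun v x => om v x ^ 2 / h v x) :=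
    ContDiffOn.div (ContDiffOn.pow hom 2) hh fun y hy => h0 _ _ hy
  have s2 := (hom.div hh h0).neg
  have s3 : Smooth₂ (vxDomain U) (fun v x => 1 / h v x) := (smooth₂_const 1).div hh h0
  have hg : ∀ i j, pd μ (fun q => nullMetricInv om h q i j) p
      = !![![0, dv (fun v x => om v x ^ 2 / h v x) (p 1) (p 2),
            dx (fun v x => om v x ^ 2 / h v x) (p 1) (p 2)] μ, 0,
          ![0, dv (fun v x => -(om v x / h v x)) (p 1) (p 2),
            dx (fun v x => -(om v x / h v x)) (p 1) (p 2)] μ;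
          0, 0, 0;
          ![0, dv (fun v x => -(om v x / h v x)) (p 1) (p 2),
            dx (fun v x => -(om v x / h v x)) (p 1) (p 2)] μ, 0,
          ![0, dv (fun v x => 1 / h v x) (p 1) (p 2),
            dx (fun v x => 1 / h v x) (p 1) (p 2)] μ] i j := by
    intro i j
    rw [← s1.pd hD hp' μ, ← s2.pd hD hp' μ, ← s3.pd hD hp' μ]
    fin_cases i <;> fin_cases j <;> first | rfl | exact pd_const _ _ _
  rw [hc]
  have hhv := hh.hasDerivAt_dv hD hp'
  have hhx := hh.hasDerivAt_dx hD hp'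
  have hov := hom.hasDerivAt_dv hD hp'
  have hox := hom.hasDerivAt_dx hD hp'
  have e1 : dv (fun v x => om v x ^ 2 / h v x) (p 1) (p 2) = _ := ((hov.pow 2).div hhv hp0).deriv
  have e2 : dx (fun v x => om v x ^ 2 / h v x) (p 1) (p 2) = _ := ((hox.pow 2).div hhx hp0).deriv
  have e3 : dv (fun v x => -(om v x / h v x)) (p 1) (p 2) = _ := ((hov.div hhv hp0).neg).deriv
  have e4 : dx (fun v x => -(om v x / h v x)) (p 1) (p 2) = _ := ((hox.div hhx hp0).neg).deriv
  have e5 : dv (fun v x => 1 / h v x) (p 1) (p 2) = _ :=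
    ((hasDerivAt_const (p 1) (1 : ℝ)).div hhv hp0).deriv
  have e6 : dx (fun v x => 1 / h v x) (p 1) (p 2) = _ :=
    ((hasDerivAt_const (p 2) (1 : ℝ)).div hhx hp0).deriv
  ext i j
  simp only [pdM, of_apply, Matrix.add_apply, transpose_apply, hg, e1, e2, e3, e4, e5, e6,
    mul_apply, Fin.sum_univ_three]
  fin_cases μ <;> fin_cases i <;> fin_cases j <;>
    simp [nullMetricInv, nullChristoffel, nullChristoffelX, nullChristoffelU] <;> field_simp <;> ring

end Vielbein

/-! ### The parallel spinor whose square is the null vector `∂_u` -/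

section ParallelSpinor

open Matrix

variable {U : Set Spacetime} {om h : ℝ → ℝ → ℝ} {e : Spacetime → Matrix (Fin 3) (Fin 3) ℝ}

theorem ContDiffOn.differentiableAt_of_isOpen {F : Spacetime → ℝ} (hF : ContDiffOn ℝ ∞ F U)
    (hU : IsOpen U) {p : Spacetime} (hp : p ∈ U) : DifferentiableAt ℝ F p :=
  ((hF p hp).contDiffAt (hU.mem_nhds hp)).differentiableAt (by simp)

/-- The covariant derivative of the inverse vielbein. -/
theorem invVielbein_mul_mink_mul_spinConnectionM
    (h0 : ∀ v x, (v, x) ∈ vxDomain U → h v x ≠ 0)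
    (he : IsVielbein U (nullMetric om h) e) {p : Spacetime} (hp : p ∈ U) (μ : Fin 3) :
    invVielbein e p * mink * spinConnectionM (nullMetric om h) e μ p
      = pdM μ (invVielbein e) p + christoffelM (nullMetric om h) μ p * invVielbein e p := by
  rw [spinConnectionM_eq, ← Matrix.mul_assoc,
    invVielbein_mul_mink_mul he hp (h0 _ _ (mem_vxDomain hp)), Matrix.one_mul]

/-- The spin connection of the null metric is antisymmetric. -/
theorem spinConnectionM_transpose (hU : IsOpen U) (hom : Smooth₂ (vxDomain U) om)
    (hh : Smooth₂ (vxDomain U) h) (h0 : ∀ v x, (v, x) ∈ vxDomain U → h v x ≠ 0)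
    (he : IsVielbein U (nullMetric om h) e) {p : Spacetime} (hp : p ∈ U) (μ : Fin 3) :
    spinConnectionM (nullMetric om h) e μ p + (spinConnectionM (nullMetric om h) e μ p)ᵀ = 0 := by
  have hp0 := h0 _ _ (mem_vxDomain hp)
  set W := spinConnectionM (nullMetric om h) e μ p with hW
  set E := invVielbein e p with hE
  set Γ := christoffelM (nullMetric om h) μ p with hΓ
  have hEW : E * mink * W = pdM μ (invVielbein e) p + Γ * E :=
    invVielbein_mul_mink_mul_spinConnectionM h0 he hp μ
  have hEE : E * (mink * Eᵀ) = nullMetricInv om h p := invVielbein_mul_mink_mul_transpose he hp hp0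
  have hEe : E * mink * e p = 1 := invVielbein_mul_mink_mul he hp hp0
  have heE : e p * (E * mink) = 1 := mul_eq_one_comm.1 hEe
  have hmt : minkᵀ = mink := diagonal_transpose _
  have hEd : ∀ i j, DifferentiableAt ℝ (fun q => invVielbein e q i j) p := fun i j =>
    ContDiffOn.differentiableAt_of_isOpen (smooth_invVielbein hom hh h0 he i j) hU hp
  have hmd : ∀ i j, DifferentiableAt ℝ (fun _ : Spacetime => mink i j) p := fun i j =>
    differentiableAt_const _
  have hEtd : ∀ i j, DifferentiableAt ℝ (fun q => (invVielbein e q)ᵀ i j) p := fun i j => hEd j i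
  have hd : pdM μ (nullMetricInv om h) p
      = pdM μ (invVielbein e) p * (mink * Eᵀ) + E * (mink * (pdM μ (invVielbein e) p)ᵀ) := by
    have hm0 : pdM μ (fun _ => mink) p = 0 := by
      ext i j; exact pd_const _ _ _
    have hmE : pdM μ (fun q => mink * (invVielbein e q)ᵀ) p
        = mink * (pdM μ (invVielbein e) p)ᵀ := by
      rw [pdM_mul hmd hEtd, hm0, Matrix.zero_mul, zero_add, pdM_transpose]
    have hmEd : ∀ i j, DifferentiableAt ℝ (fun q => (mink * (invVielbein e q)ᵀ) i j) p := by
      intro i j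
      simp only [mul_apply]
      exact DifferentiableAt.fun_sum fun k _ => (hmd i k).fun_mul (hEtd k j)
    rw [← hmE, ← pdM_mul hEd hmEd]
    exact (pdM_congr hU (fun q hq =>
      invVielbein_mul_mink_mul_transpose he hq (h0 _ _ (mem_vxDomain hq))) hp μ).symm
  -- Transported to coordinate indices by the inverse vielbein `E * mink`, the symmetric part of the
  -- spin connection is the covariant derivative of `g⁻¹`, which vanishes.
  have key : E * mink * (W + Wᵀ) * (E * mink)ᵀ = 0 := by
    have h1 : E * mink * W * (E * mink)ᵀ
        = pdM μ (invVielbein e) p * (mink * Eᵀ) + Γ * nullMetricInv om h p := by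
      rw [hEW, transpose_mul, hmt, Matrix.add_mul, Matrix.mul_assoc Γ, hEE]
    have h2 : E * mink * Wᵀ * (E * mink)ᵀ
        = E * (mink * (pdM μ (invVielbein e) p)ᵀ) + (Γ * nullMetricInv om h p)ᵀ := by
      rw [← hEE, Matrix.mul_assoc, ← transpose_mul, hEW, transpose_add, Matrix.mul_add]
      simp only [transpose_mul, transpose_transpose, hmt, Matrix.mul_assoc]
    rw [Matrix.mul_add, Matrix.add_mul, h1, h2,
      ← pdM_nullMetricInv hU hom hh h0 hp μ, hd]
    abel
  have hfin : e p * (E * mink * (W + Wᵀ) * (E * mink)ᵀ) * (e p)ᵀ = W + Wᵀ := by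
    rw [Matrix.mul_assoc, Matrix.mul_assoc, ← transpose_mul, heE, transpose_one, Matrix.mul_one,
      ← Matrix.mul_assoc, heE, Matrix.one_mul]
  rw [← hfin, key, Matrix.mul_zero, Matrix.zero_mul]

theorem spinConnection_antisymm (hU : IsOpen U) (hom : Smooth₂ (vxDomain U) om)
    (hh : Smooth₂ (vxDomain U) h) (h0 : ∀ v x, (v, x) ∈ vxDomain U → h v x ≠ 0)
    (he : IsVielbein U (nullMetric om h) e) {p : Spacetime} (hp : p ∈ U) (μ a b : Fin 3) :
    spinConnection (nullMetric om h) e μ a b p = -spinConnection (nullMetric om h) e μ b a p :=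
  eq_neg_of_add_eq_zero_left
    (congrFun (congrFun (spinConnectionM_transpose hU hom hh h0 he hp μ) a) b)

/-- Row `v` of `g⁻¹` is `(-1, 0, 0)`. This gives `γ^v = -e^a_u γ_a` and so ties `γ^v` to the
parallel vector `∂_u`. -/
theorem invVielbein_one (h0 : ∀ v x, (v, x) ∈ vxDomain U → h v x ≠ 0)
    (he : IsVielbein U (nullMetric om h) e) {p : Spacetime} (hp : p ∈ U) (b : Fin 3) :
    invVielbein e p 1 b = -e p b 0 := by
  rw [invVielbein_eq he hp (h0 _ _ (mem_vxDomain hp))]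
  simp [mul_apply, Fin.sum_univ_three, nullMetricInv]

/-- The null vector field `∂_u` is parallel. -/
theorem pd_vielbein_zero (hU : IsOpen U) (hom : Smooth₂ (vxDomain U) om)
    (hh : Smooth₂ (vxDomain U) h) (h0 : ∀ v x, (v, x) ∈ vxDomain U → h v x ≠ 0)
    (he : IsVielbein U (nullMetric om h) e) {p : Spacetime} (hp : p ∈ U) (μ b : Fin 3) :
    pd μ (fun q => e q b 0) p
      = -(e p 0 0 * spinConnection (nullMetric om h) e μ 0 b p)
        + e p 1 0 * spinConnection (nullMetric om h) e μ 1 b p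
        + e p 2 0 * spinConnection (nullMetric om h) e μ 2 b p := by
  have h1 := congrFun (congrFun (invVielbein_mul_mink_mul_spinConnectionM h0 he hp μ) 1) b
  -- `Γ^v_{μν} = 0` is the reason why `∂_u` is parallel.
  have hΓ : (christoffelM (nullMetric om h) μ p * invVielbein e p) 1 b = 0 := by
    rw [mul_apply]
    refine Finset.sum_eq_zero fun l _ => ?_
    have : christoffelM (nullMetric om h) μ p 1 l = 0 :=
      christoffel_nullMetric (isOpen_vxDomain hU) hom hh (mem_vxDomain hp)
        (h0 _ _ (mem_vxDomain hp)) 1 μ l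
    rw [this, zero_mul]
  have hE : pd μ (fun q => invVielbein e q 1 b) p = -pd μ (fun q => e q b 0) p := by
    rw [← pd_neg]
    exact pd_congr hU (fun q hq => invVielbein_one h0 he hq b) hp μ
  rw [Matrix.add_apply, hΓ, add_zero, pdM, of_apply, hE, mink, mul_apply] at h1
  simp only [mul_diagonal, Fin.sum_univ_three, invVielbein_one h0 he hp, spinConnectionM,
    of_apply, cons_val_zero, cons_val_one, cons_val_two, head_cons, tail_cons] at h1
  linear_combination h1

theorem vielbein_zero_null (he : IsVielbein U (nullMetric om h) e) {p : Spacetime} (hp : p ∈ U) :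
    e p 0 0 ^ 2 = e p 1 0 ^ 2 + e p 2 0 ^ 2 := by
  have h1 := congrFun (congrFun (he.orthonormal p hp) 0) 0
  simp [mul_apply, mink, diagonal_apply, Fin.sum_univ_three, nullMetric] at h1
  linarith

/-- A null vector with vanishing time component is zero, but `∂_u` is not, since `g_uv = -1`. -/
theorem vielbein_zero_zero_ne_zero (he : IsVielbein U (nullMetric om h) e) {p : Spacetime}
    (hp : p ∈ U) : e p 0 0 ≠ 0 := by
  intro h00
  have hn := vielbein_zero_null he hp
  rw [h00] at hn
  have h10 : e p 1 0 = 0 := by nlinarith [sq_nonneg (e p 1 0), sq_nonneg (e p 2 0)]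
  have h20 : e p 2 0 = 0 := by nlinarith [sq_nonneg (e p 1 0), sq_nonneg (e p 2 0)]
  have h1 := congrFun (congrFun (he.orthonormal p hp) 0) 1
  simp [mul_apply, mink, diagonal_apply, Fin.sum_univ_three, nullMetric, h00, h10, h20] at h1

/-- The spin connection in the spinor representation, `¼ ω^{ab} γ_{ab}`. -/
noncomputable def spinMatrix (w : Fin 3 → Fin 3 → ℝ) : Matrix (Fin 2) (Fin 2) ℝ :=
  !![w 0 1 / 2, -(w 0 2 + w 1 2) / 2; (w 1 2 - w 0 2) / 2, -w 0 1 / 2]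

/-- Antisymmetry leaves three independent components, with `γ_01 = τ₃`, `γ_02 = -τ₁` and `γ_12 =
-ε`. -/
theorem quarter_sum_gammaFlat₂ {w : Fin 3 → Fin 3 → ℝ} (hw : ∀ a b, w a b = -w b a)
    (y : Fin 2 → ℝ) (α : Fin 2) :
    (1 / 4) * (∑ a, ∑ b, w a b * (gammaFlat₂ a b *ᵥ y) α) = (spinMatrix w *ᵥ y) α := by
  have h00 : w 0 0 = 0 := by linarith [hw 0 0]
  have h11 : w 1 1 = 0 := by linarith [hw 1 1]
  have h22 : w 2 2 = 0 := by linarith [hw 2 2]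
  simp only [Fin.sum_univ_three, h00, h11, h22, hw 1 0, hw 2 0, hw 2 1]
  fin_cases α <;>
    simp [gammaFlat₂, gammaFlat, spinMatrix, mulVec, dotProduct, Fin.sum_univ_two] <;> ring

/-- A parallel spinor annihilated by `γ^v`. -/
theorem exists_parallel_spinor (hU : IsOpen U) (hUc : Convex ℝ U) (hUn : U.Nonempty)
    (hom : Smooth₂ (vxDomain U) om)
    (hh : Smooth₂ (vxDomain U) h) (h0 : ∀ v x, (v, x) ∈ vxDomain U → h v x ≠ 0)
    (he : IsVielbein U (nullMetric om h) e) :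
    ∃ ξ : Spacetime → Fin 2 → ℝ, (∀ p ∈ U, ∀ α, DifferentiableAt ℝ (fun q => ξ q α) p) ∧
      (∀ p ∈ U, ξ p 0 ^ 2 + ξ p 1 ^ 2 ≠ 0) ∧
      (∃ s : ℝ, s ≠ 0 ∧ ∀ p ∈ U, gammaCurved e 1 p =
        (2 * s) • !![ξ p 0 * ξ p 1, -(ξ p 0 * ξ p 0); ξ p 1 * ξ p 1, -(ξ p 0 * ξ p 1)]) ∧
      ∀ p ∈ U, ∀ μ α, pd μ (fun q => ξ q α) p
        = -(spinMatrix (fun a b => spinConnection (nullMetric om h) e μ a b p) *ᵥ ξ p) α := by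
  -- The sign of `e^0_u` is constant on the connected set `U`. It has to be normalised because the
  -- square of a real spinor has positive time component.
  obtain ⟨s, hs, hspos⟩ : ∃ s : ℝ, s ^ 2 = 1 ∧ ∀ p ∈ U, 0 < s * e p 0 0 := by
    have hc : ContinuousOn (fun p => e p 0 0) U := (he.smooth 0 0).continuousOn
    have hne : ∀ p ∈ U, e p 0 0 ≠ 0 := fun p hp => vielbein_zero_zero_ne_zero he hp
    by_cases hall : ∀ p ∈ U, 0 < e p 0 0
    · exact ⟨1, by norm_num, fun p hp => by simpa using hall p hp⟩
    · push Not at hall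
      obtain ⟨p₁, hp₁, hneg⟩ := hall
      refine ⟨-1, by norm_num, fun p hp => ?_⟩
      by_contra hcon
      have hpos : 0 ≤ e p 0 0 := by linarith
      obtain ⟨q, hq, hq0⟩ := hUc.isPreconnected.intermediate_value hp₁ hp hc
        (Set.mem_Icc.2 ⟨hneg, hpos⟩)
      exact hne q hq hq0
  have hs0 : s ≠ 0 := by rintro rfl; norm_num at hs
  -- The spinor `ξ = (x, y)` should satisfy `x² + y² = s e^0_u`, `x² - y² = s e^1_u` and `2xy = -s
  -- e^2_u`. The last two say `(x + iy)² = s (e^1_u - i e^2_u)`; the first then follows from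
  -- nullness and the choice of `s`.
  obtain ⟨z, hzd, hz⟩ := exists_sqrt_of_convex hU hUc hUn
    (w := fun p => ((s * e p 1 0 : ℝ) : ℂ) + ((-(s * e p 2 0) : ℝ) : ℂ) * Complex.I)
    (by
      have h1 : ContDiffOn ℝ ∞ (fun p => ((s * e p 1 0 : ℝ) : ℂ)) U :=
        Complex.ofRealCLM.contDiff.comp_contDiffOn (contDiffOn_const.mul (he.smooth 1 0))
      have h2 : ContDiffOn ℝ ∞ (fun p => ((-(s * e p 2 0) : ℝ) : ℂ)) U :=
        Complex.ofRealCLM.contDiff.comp_contDiffOn (contDiffOn_const.mul (he.smooth 2 0)).neg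
      exact h1.add (h2.mul contDiffOn_const))
    (by
      intro p hp hw
      have h1 := congrArg Complex.re hw
      have h2 := congrArg Complex.im hw
      simp [hs0] at h1 h2
      have hn := vielbein_zero_null he hp
      rw [h1, h2] at hn
      exact vielbein_zero_zero_ne_zero he hp (by simpa using hn))
  have hre : ∀ p ∈ U, (z p).re ^ 2 - (z p).im ^ 2 = s * e p 1 0 := by
    intro p hp
    have := congrArg Complex.re (hz p hp)
    simp [pow_two] at this
    linarith
  have him : ∀ p ∈ U, (z p).re * (z p).im = -(s * e p 2 0) / 2 := by
    intro p hp
    have := congrArg Complex.im (hz p hp)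
    simp [pow_two] at this
    linarith
  have hab : ∀ p ∈ U, (z p).re ^ 2 + (z p).im ^ 2 = s * e p 0 0 := by
    intro p hp
    have h1 : ((z p).re ^ 2 + (z p).im ^ 2) ^ 2 = (s * e p 0 0) ^ 2 := by
      rw [mul_pow, vielbein_zero_null he hp]
      linear_combination ((z p).re ^ 2 - (z p).im ^ 2 + s * e p 1 0) * hre p hp
        + 4 * ((z p).re * (z p).im - s * e p 2 0 / 2) * him p hp
    exact (pow_left_inj₀ (by positivity) (hspos p hp).le two_ne_zero).1 h1
  have hzd' : ∀ p ∈ U, DifferentiableAt ℝ z p := fun p hp =>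
    (hzd p hp).differentiableAt (hU.mem_nhds hp)
  have hxd : ∀ p ∈ U, DifferentiableAt ℝ (fun q => (z q).re) p := fun p hp =>
    Complex.reCLM.differentiableAt.comp p (hzd' p hp)
  have hyd : ∀ p ∈ U, DifferentiableAt ℝ (fun q => (z q).im) p := fun p hp =>
    Complex.imCLM.differentiableAt.comp p (hzd' p hp)
  refine ⟨fun p => ![(z p).re, (z p).im], fun p hp α => ?_, fun p hp => ?_,
    ⟨s, hs0, fun p hp => ?_⟩, fun p hp μ => ?_⟩
  · fin_cases α
    · exact hxd p hp
    · exact hyd p hp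
  · simpa [hab p hp] using ⟨hs0, vielbein_zero_zero_ne_zero he hp⟩
  · have e1 := hre p hp
    have e2 := him p hp
    have e3 := hab p hp
    ext i j
    simp only [gammaCurved, Fin.sum_univ_three, invVielbein_one h0 he hp]
    fin_cases i <;> fin_cases j <;> simp [gammaFlat]
    · linear_combination -(2 * s) * e2 + e p 2 0 * hs
    · linear_combination s * e1 + s * e3 + (e p 0 0 + e p 1 0) * hs
    · linear_combination s * e1 - s * e3 + (e p 1 0 - e p 0 0) * hs
    · linear_combination (2 * s) * e2 - e p 2 0 * hs
  · set x := (z p).re with hx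
    set y := (z p).im with hy
    set x' := pd μ (fun q => (z q).re) p with hx'
    set y' := pd μ (fun q => (z q).im) p with hy'
    have hed : ∀ b, DifferentiableAt ℝ (fun q => e q b 0) p := fun b =>
      ContDiffOn.differentiableAt_of_isOpen (he.smooth b 0) hU hp
    have hsd : DifferentiableAt ℝ (fun _ : Spacetime => s) p := differentiableAt_const _
    have hxp := hxd p hp
    have hyp := hyd p hp
    have d1 : x' * x + x * x' - (y' * y + y * y') = s * pd μ (fun q => e q 1 0) p := by
      have h1 := pd_congr hU (F := fun q => (z q).re * (z q).re - (z q).im * (z q).im)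
        (G := fun q => s * e q 1 0) (fun q hq => by rw [← hre q hq]; ring) hp μ
      rwa [pd_sub (hxp.fun_mul hxp) (hyp.fun_mul hyp), pd_mul hxp hxp, pd_mul hyp hyp,
        pd_mul hsd (hed 1), pd_const, zero_mul, zero_add] at h1
    have d2 : x' * x + x * x' + (y' * y + y * y') = s * pd μ (fun q => e q 0 0) p := by
      have h1 := pd_congr hU (F := fun q => (z q).re * (z q).re + (z q).im * (z q).im)
        (G := fun q => s * e q 0 0) (fun q hq => by rw [← hab q hq]; ring) hp μ
      rwa [pd_add (hxp.fun_mul hxp) (hyp.fun_mul hyp), pd_mul hxp hxp, pd_mul hyp hyp,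
        pd_mul hsd (hed 0), pd_const, zero_mul, zero_add] at h1
    have d3 : x' * y + x * y' = -s / 2 * pd μ (fun q => e q 2 0) p := by
      have hsd' : DifferentiableAt ℝ (fun _ : Spacetime => -s / 2) p := differentiableAt_const _
      have h1 := pd_congr hU (F := fun q => (z q).re * (z q).im)
        (G := fun q => -s / 2 * e q 2 0) (fun q hq => by rw [him q hq]; ring) hp μ
      rwa [pd_mul hxp hyp, pd_mul hsd' (hed 2), pd_const, zero_mul, zero_add] at h1
    rw [pd_vielbein_zero hU hom hh h0 he hp] at d1 d2 d3
    have ha := spinConnection_antisymm hU hom hh h0 he hp μ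
    have e1 : x ^ 2 - y ^ 2 = s * e p 1 0 := hre p hp
    have e2 : x * y = -(s * e p 2 0) / 2 := him p hp
    have e3 : x ^ 2 + y ^ 2 = s * e p 0 0 := hab p hp
    generalize spinConnection (nullMetric om h) e μ = W at ha d1 d2 d3 ⊢
    have a00 : W 0 0 p = 0 := by linarith [ha 0 0]
    have a11 : W 1 1 p = 0 := by linarith [ha 1 1]
    have a22 : W 2 2 p = 0 := by linarith [ha 2 2]
    rw [ha 2 1, a11] at d1
    rw [ha 1 0, ha 2 0, a00] at d2
    rw [a22] at d3
    have hpos : x ^ 2 + y ^ 2 ≠ 0 := by rw [e3]; exact (hspos p hp).ne'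
    -- `A` and `B` are the components of the covariant derivative of `ξ`. Differentiating the three
    -- quadratic relations shows that its symmetric product with `ξ` vanishes (`f1`, `f2`, `f3`); as
    -- `ξ ≠ 0`, both components are zero.
    set A := x' + (W 0 1 p * x - (W 0 2 p + W 1 2 p) * y) / 2 with hA
    set B := y' + ((W 1 2 p - W 0 2 p) * x - W 0 1 p * y) / 2 with hB
    have f1 : x * A = 0 := by
      rw [hA]
      linear_combination (d1 + d2) / 4 + W 0 1 p / 4 * (e1 + e3) - (W 0 2 p + W 1 2 p) / 2 * e2
    have f2 : y * B = 0 := by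
      rw [hB]
      linear_combination (d2 - d1) / 4 + W 0 1 p / 4 * (e1 - e3) + (W 1 2 p - W 0 2 p) / 2 * e2
    have f3 : x * B + y * A = 0 := by
      rw [hA, hB]
      linear_combination d3 + W 1 2 p / 2 * e1 - W 0 2 p / 2 * e3
    have hA0 : A = 0 := by
      have : (x ^ 2 + y ^ 2) * A = 0 := by linear_combination x * f1 + y * f3 - x * f2
      exact (mul_eq_zero.1 this).resolve_left hpos
    have hB0 : B = 0 := by
      have : (x ^ 2 + y ^ 2) * B = 0 := by linear_combination y * f2 + x * f3 - y * f1
      exact (mul_eq_zero.1 this).resolve_left hpos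
    intro α
    fin_cases α
    · have : x' = -((W 0 1 p * x - (W 0 2 p + W 1 2 p) * y) / 2) := by linarith
      simp [spinMatrix, mulVec, dotProduct, Fin.sum_univ_two]
      rw [← hx', this]
      ring
    · have : y' = -(((W 1 2 p - W 0 2 p) * x - W 0 1 p * y) / 2) := by linarith
      simp [spinMatrix, mulVec, dotProduct, Fin.sum_univ_two]
      rw [← hy', this]
      ring

end ParallelSpinor

/-- A linear system of differential equations on an open interval has a fundamental solution. -/
theorem exists_linear_system_solution {ι : Type*} [Fintype ι] {B : ℝ → ι → ι → ℝ} {J : Set ℝ}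
    (hJ : IsOpen J) (hJc : J.OrdConnected) (hB : ∀ i j, ContinuousOn (fun t => B t i j) J) {t₀ : ℝ}
    (ht₀ : t₀ ∈ J) :
    ∃ R : ℝ → (ι → ℝ) →L[ℝ] (ι → ℝ), R t₀ = 1 ∧
      ∀ t ∈ J, ∀ c i, HasDerivAt (fun s => R s c i) (∑ j, B t i j * R t c j) t := by
  classical
  let T : (ι → ι → ℝ) →ₗ[ℝ] (ι → ℝ) →L[ℝ] (ι → ℝ) :=
    LinearMap.toContinuousLinearMap.toLinearMap ∘ₗ Matrix.toLin'.toLinearMap ∘ₗ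
      (Matrix.ofLinearEquiv ℝ).toLinearMap
  have hT : ∀ (M : ι → ι → ℝ) (c : ι → ℝ) (i : ι), T M c i = ∑ j, M i j * c j := fun M c i => rfl
  have hTc : ContinuousOn (fun t => T (B t)) J :=
    T.continuous_of_finiteDimensional.comp_continuousOn
      (continuousOn_pi.2 fun i => continuousOn_pi.2 fun j => hB i j)
  obtain ⟨R, hR0, hR⟩ := exists_fundamental_solution hJ hJc hTc ht₀
  refine ⟨R, hR0, fun t ht c i => ?_⟩
  have h1 : HasDerivAt (fun s => R s c) ((T (B t) * R t) c) t := by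
    simpa using (hR t ht).clm_apply (hasDerivAt_const t c)
  exact hasDerivAt_pi.1 h1 i

/-! ### The dimension of the space of Killing spinors -/

section Killing

open Matrix

variable {U : Set Spacetime} {om h : ℝ → ℝ → ℝ} {e : Spacetime → Matrix (Fin 3) (Fin 3) ℝ}
  {P : Fin 3 → Spacetime → SpinIdx → ℝ} {Q : Fin 3 → Spacetime → SO16Alg}

theorem gravitinoVariation_eq (hU : IsOpen U) (hom : Smooth₂ (vxDomain U) om)
    (hh : Smooth₂ (vxDomain U) h) (h0 : ∀ v x, (v, x) ∈ vxDomain U → h v x ≠ 0)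
    (he : IsVielbein U (nullMetric om h) e) (ε : Spacetime → SusyParam) {p : Spacetime}
    (hp : p ∈ U) (μ : Fin 3) (I : VecIdx) (α : Fin 2) :
    gravitinoVariation (nullMetric om h) e Q ε μ I α p
      = pd μ (fun q => ε q I α) p
        + (spinMatrix (fun a b => spinConnection (nullMetric om h) e μ a b p) *ᵥ ε p I) α
        + ∑ J, (Q μ p : Matrix VecIdx VecIdx ℝ) I J * ε p J α := by
  rw [gravitinoVariation,
    quarter_sum_gammaFlat₂ (fun a b => spinConnection_antisymm hU hom hh h0 he hp μ a b)]

theorem dilatinoVariation_eq (hPQ : ∀ p ∈ U, ∀ μ, μ ≠ 1 → P μ p = 0 ∧ Q μ p = 0)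
    (ε : Spacetime → SusyParam) {p : Spacetime} (hp : p ∈ U) (B : CoSpinIdx) (α : Fin 2) :
    dilatinoVariation e P ε B α p
      = ∑ I, (gammaCurved e 1 p *ᵥ ε p I) α * (gammaSO16 I *ᵥ P 1 p) B := by
  rw [dilatinoVariation]
  refine Finset.sum_eq_single 1 (fun μ _ hμ => Finset.sum_eq_zero fun I _ => ?_) (by simp)
  rw [(hPQ p hp μ hμ).1, mulVec_zero, Pi.zero_apply, mul_zero]

theorem continuousOn_pd (hU : IsOpen U) {F : Spacetime → ℝ} (hF : ContDiffOn ℝ ∞ F U)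
    (μ : Fin 3) : ContinuousOn (fun p => pd μ F p) U := by
  have h1 : ContinuousOn (fderiv ℝ F) U :=
    ((contDiffOn_infty_iff_fderiv_of_isOpen hU).1 hF).2.continuousOn
  exact h1.clm_apply continuousOn_const

theorem continuousOn_spinConnection (hU : IsOpen U) (hom : Smooth₂ (vxDomain U) om)
    (hh : Smooth₂ (vxDomain U) h) (h0 : ∀ v x, (v, x) ∈ vxDomain U → h v x ≠ 0)
    (he : IsVielbein U (nullMetric om h) e) (μ a b : Fin 3) :
    ContinuousOn (spinConnection (nullMetric om h) e μ a b) U := by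
  have hE := smooth_invVielbein hom hh h0 he
  have hΓ : ∀ ρ μ ν, ContinuousOn (christoffel (nullMetric om h) ρ μ ν) U := fun ρ μ ν =>
    (smooth_nullChristoffel (isOpen_vxDomain hU) hom hh h0 ρ μ ν).comp_spacetime.continuousOn.congr
      fun p hp => christoffel_nullMetric (isOpen_vxDomain hU) hom hh (mem_vxDomain hp)
        (h0 _ _ (mem_vxDomain hp)) ρ μ ν
  refine continuousOn_finsetSum _ fun ν _ => (he.smooth a ν).continuousOn.mul
    ((continuousOn_pd hU (hE ν b) μ).add (continuousOn_finsetSum _ fun l _ => ?_))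
  exact (hΓ ν μ l).mul (hE l b).continuousOn

theorem continuousOn_spinMatrix {w : Spacetime → Fin 3 → Fin 3 → ℝ}
    (hw : ∀ a b, ContinuousOn (fun p => w p a b) U) (α β : Fin 2) :
    ContinuousOn (fun p => spinMatrix (w p) α β) U := by
  fin_cases α <;> fin_cases β
  · exact (hw 0 1).div_const 2
  · exact ((hw 0 2).add (hw 1 2)).neg.div_const 2
  · exact ((hw 1 2).sub (hw 0 2)).div_const 2
  · exact (hw 0 1).neg.div_const 2

/-- A Killing spinor that vanishes at a point vanishes. -/
theorem killingSpinor_eq_zero (hU : IsOpen U) (hUc : Convex ℝ U) (hom : Smooth₂ (vxDomain U) om)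
    (hh : Smooth₂ (vxDomain U) h) (h0 : ∀ v x, (v, x) ∈ vxDomain U → h v x ≠ 0)
    (he : IsVielbein U (nullMetric om h) e)
    (hQ : ∀ μ I J, ContinuousOn (fun p => (Q μ p : Matrix VecIdx VecIdx ℝ) I J) U)
    {ε : Spacetime → SusyParam} (hε : ε ∈ killingSpinors U hU (nullMetric om h) e P Q)
    {p : Spacetime} (hp : p ∈ U) (hεp : ε p = 0) : ε = 0 := by
  obtain ⟨hεd, hε0, hεg, -⟩ := hε
  ext1 q
  by_cases hq : q ∈ U
  swap
  · rw [hε0 q hq]; rfl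
  -- Along the segment from `p` to `q` the gravitino equation is a linear system for all 32
  -- components, with initial value 0.
  set γ : ℝ → Spacetime := fun t => p + t • (q - p) with hγ
  have hγU : ∀ t ∈ Set.Icc (0 : ℝ) 1, γ t ∈ U := fun t ht =>
    hUc.add_smul_sub_mem hp hq ht
  have hγc : ContinuousOn γ (Set.Icc 0 1) := by fun_prop
  let S : Fin 3 → Spacetime → Matrix (Fin 2) (Fin 2) ℝ := fun μ r =>
    spinMatrix (fun a b => spinConnection (nullMetric om h) e μ a b r)
  have key := linear_ode_eq_zero (φ := fun t (i : VecIdx × Fin 2) => ε (γ t) i.1 i.2)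
    (B := fun t i j => ∑ μ, -(q - p) μ * ((if i.1 = j.1 then S μ (γ t) i.2 j.2 else 0)
      + (if i.2 = j.2 then (Q μ (γ t) : Matrix VecIdx VecIdx ℝ) i.1 j.1 else 0))) ?_ ?_ ?_
  · have hγ1 : γ 1 = q := by simp [hγ]
    ext I α
    have := congrFun key (I, α)
    simpa [hγ1] using this
  · intro i j
    refine continuousOn_finsetSum _ fun μ _ => continuousOn_const.mul (ContinuousOn.add ?_ ?_)
    · split_ifs
      · exact (continuousOn_spinMatrix (fun a b =>
          continuousOn_spinConnection hU hom hh h0 he μ a b) i.2 j.2).comp hγc hγU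
      · exact continuousOn_const
    · split_ifs
      · exact (hQ μ i.1 j.1).comp hγc hγU
      · exact continuousOn_const
  · rintro t ht ⟨I, α⟩
    have hd : HasFDerivAt (fun r => ε r I α) (fderiv ℝ (fun r => ε r I α) (γ t)) (γ t) :=
      (differentiableAt_comp hU hεd (hγU t ht) I α).hasFDerivAt
    have hγd : HasDerivAt γ (q - p) t := by
      have := ((hasDerivAt_id t).smul_const (q - p)).const_add p
      rwa [one_smul] at this
    refine (hd.comp_hasDerivAt t hγd).congr_deriv ?_
    have hsum : (q - p) = ∑ μ, (q - p) μ • (Pi.single μ 1 : Spacetime) := by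
      ext i
      simp [Pi.single_apply]
    have h1 : fderiv ℝ (fun r => ε r I α) (γ t) (q - p)
        = ∑ μ, (q - p) μ * pd μ (fun r => ε r I α) (γ t) := by
      conv_lhs => rw [hsum]
      rw [map_sum]
      exact Finset.sum_congr rfl fun μ _ => by rw [map_smul, smul_eq_mul, pd]
    rw [h1]
    simp_rw [Finset.sum_mul]
    rw [Finset.sum_comm]
    refine Finset.sum_congr rfl fun μ _ => ?_
    have h2 := hεg (γ t) (hγU t ht) μ I α
    rw [gravitinoVariation_eq hU hom hh h0 he ε (hγU t ht)] at h2
    have h3 : ∑ j : VecIdx × Fin 2, (if I = j.1 then S μ (γ t) α j.2 else 0) * ε (γ t) j.1 j.2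
        = (S μ (γ t) *ᵥ ε (γ t) I) α := by
      rw [Fintype.sum_prod_type]
      simp [mulVec, dotProduct]
    have h4 : ∑ j : VecIdx × Fin 2, (if α = j.2 then (Q μ (γ t) : Matrix VecIdx VecIdx ℝ) I j.1
        else 0) * ε (γ t) j.1 j.2 = ∑ J, (Q μ (γ t) : Matrix VecIdx VecIdx ℝ) I J * ε (γ t) J α := by
      rw [Fintype.sum_prod_type]
      exact Finset.sum_congr rfl fun J _ => by simp
    simp_rw [mul_assoc, add_mul]
    rw [← Finset.mul_sum, Finset.sum_add_distrib, h3, h4]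
    linear_combination (q - p) μ * h2
  · ext i
    simp [hγ, hεp]

theorem hasFDerivAt_comp_v {a : ℝ → ℝ} {a' : ℝ} {p : Spacetime} (ha : HasDerivAt a a' (p 1)) :
    HasFDerivAt (fun q : Spacetime => a (q 1))
      (a' • ContinuousLinearMap.proj (R := ℝ) (φ := fun _ : Fin 3 => ℝ) 1) p :=
  ha.comp_hasFDerivAt p (hasFDerivAt_apply 1 p)

theorem pd_comp_v {a : ℝ → ℝ} {a' : ℝ} {p : Spacetime} (ha : HasDerivAt a a' (p 1)) (μ : Fin 3) :
    pd μ (fun q => a (q 1)) p = if μ = 1 then a' else 0 := by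
  rw [pd, (hasFDerivAt_comp_v ha).fderiv]
  simp [Pi.single_apply, eq_comm]

open Classical in
/-- Half of the supersymmetry is preserved, and exactly half of it unless `P_v = 0`. -/
theorem finrank_killingSpinors (hU : IsOpen U) (hUc : Convex ℝ U) (hUn : U.Nonempty)
    (hom : Smooth₂ (vxDomain U) om)
    (hh : Smooth₂ (vxDomain U) h) (h0 : ∀ v x, (v, x) ∈ vxDomain U → h v x ≠ 0)
    (he : IsVielbein U (nullMetric om h) e)
    (hPQ : ∀ p ∈ U, ∀ μ, μ ≠ 1 → P μ p = 0 ∧ Q μ p = 0) {Pv : ℝ → SpinIdx → ℝ}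
    (hPv : ∀ p ∈ U, P 1 p = Pv (p 1))
    (hQ : ∀ μ I J, ContDiffOn ℝ ∞ (fun p => (Q μ p : Matrix VecIdx VecIdx ℝ) I J) U)
    {Qv : ℝ → SO16Alg} (hQv : ∀ p ∈ U, Q 1 p = Qv (p 1)) :
    Module.finrank ℝ SusyParam
        ≤ 2 * Module.finrank ℝ (killingSpinors U hU (nullMetric om h) e P Q) ∧
      ((∃ p ∈ U, Pv (p 1) ≠ 0) →
        2 * Module.finrank ℝ (killingSpinors U hU (nullMetric om h) e P Q)
          = Module.finrank ℝ SusyParam) := by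
  have hsusy : Module.finrank ℝ SusyParam = 2 * Module.finrank ℝ (VecIdx → ℝ) := by
    simp [Module.finrank_pi_fintype]
  have hQc : ∀ μ I J, ContinuousOn (fun p => (Q μ p : Matrix VecIdx VecIdx ℝ) I J) U :=
    fun μ I J => (hQ μ I J).continuousOn
  obtain ⟨ξ, hξd, hξ0, ⟨s, hs, hξγ⟩, hξp⟩ := exists_parallel_spinor hU hUc hUn hom hh h0 he
  have hγξ : ∀ p ∈ U, gammaCurved e 1 p *ᵥ ξ p = 0 := by
    intro p hp
    rw [hξγ p hp]
    ext α
    fin_cases α <;> simp [mulVec, dotProduct, Fin.sum_univ_two] <;> ring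
  obtain ⟨p₀, hp₀⟩ := hUn
  let evp : (p : Spacetime) → killingSpinors U hU (nullMetric om h) e P Q →ₗ[ℝ] SusyParam :=
    fun p => LinearMap.proj p ∘ₗ Submodule.subtype _
  have hevp : ∀ p ∈ U, Function.Injective (evp p) := fun p hp => by
    rw [← LinearMap.ker_eq_bot, LinearMap.ker_eq_bot']
    intro ε hε
    exact Subtype.ext (killingSpinor_eq_zero hU hUc hom hh h0 he hQc ε.2 hp hε)
  -- In infinite dimension `finrank` would be 0, so the lower bound depends on this.
  have hfin : FiniteDimensional ℝ (killingSpinors U hU (nullMetric om h) e P Q) :=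
    FiniteDimensional.of_injective _ (hevp p₀ hp₀)
  have hQvs : ∀ I J, ContinuousOn (fun v => (Qv v : Matrix VecIdx VecIdx ℝ) I J) (vDomain U) :=
    fun I J => (contDiffOn_of_factor_v hU (hQ 1 I J)
      (G := fun v => (Qv v : Matrix VecIdx VecIdx ℝ) I J)
      (fun p hp => by rw [hQv p hp])).continuousOn
  -- `R` transports the index `I` against `Q_v`, while `ξ` takes care of the spin connection; the
  -- product of the two solves the gravitino equation.
  obtain ⟨R, hR0, hR⟩ := exists_linear_system_solution (isOpen_vDomain hU)
    (ordConnected_vDomain hUc) (B := fun v I J => -(Qv v : Matrix VecIdx VecIdx ℝ) I J)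
    (fun I J => (hQvs I J).neg) (t₀ := p₀ 1) ⟨p₀, hp₀, rfl⟩
  let ε : (VecIdx → ℝ) → Spacetime → SusyParam := fun c q I α =>
    if q ∈ U then R (q 1) c I * ξ q α else 0
  have hεU : ∀ c, ∀ q ∈ U, ∀ I α, ε c q I α = R (q 1) c I * ξ q α := fun c q hq I α => if_pos hq
  have hRd : ∀ p ∈ U, ∀ c I, HasDerivAt (fun v => R v c I)
      (∑ J, -(Qv (p 1) : Matrix VecIdx VecIdx ℝ) I J * R (p 1) c J) (p 1) := fun p hp c I =>
    hR (p 1) ⟨p, hp, rfl⟩ c I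
  have hmem : ∀ c, ε c ∈ killingSpinors U hU (nullMetric om h) e P Q := by
    intro c
    have hprod : ∀ p ∈ U, ∀ I α, DifferentiableAt ℝ (fun q => R (q 1) c I * ξ q α) p :=
      fun p hp I α => (hasFDerivAt_comp_v (hRd p hp c I)).differentiableAt.fun_mul (hξd p hp α)
    have hrow : ∀ p ∈ U, ∀ I, ε c p I = R (p 1) c I • ξ p := fun p hp I => by
      ext α; rw [hεU c p hp]; rfl
    refine ⟨fun p hp => ?_, fun p hp => ?_, fun p hp μ I α => ?_, fun p hp B α => ?_⟩
    · refine DifferentiableAt.differentiableWithinAt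
        (differentiableAt_pi.2 fun I => differentiableAt_pi.2 fun α => ?_)
      refine (hprod p hp I α).congr_of_eventuallyEq ?_
      filter_upwards [hU.mem_nhds hp] with q hq using hεU c q hq I α
    · ext I α
      exact if_neg hp
    · rw [gravitinoVariation_eq hU hom hh h0 he _ hp,
        pd_congr hU (fun q hq => hεU c q hq I α) hp μ,
        pd_mul (hasFDerivAt_comp_v (hRd p hp c I)).differentiableAt (hξd p hp α),
        pd_comp_v (hRd p hp c I), hξp p hp, hrow p hp, mulVec_smul, Pi.smul_apply, smul_eq_mul]
      have hQs : (∑ J, (Q μ p : Matrix VecIdx VecIdx ℝ) I J * ε c p J α)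
          = -((if μ = 1 then ∑ J, -(Qv (p 1) : Matrix VecIdx VecIdx ℝ) I J * R (p 1) c J else 0)
            * ξ p α) := by
        split_ifs with hμ
        · rw [hμ, hQv p hp, Finset.sum_mul, ← Finset.sum_neg_distrib]
          exact Finset.sum_congr rfl fun J _ => by rw [hεU c p hp]; ring
        · rw [(hPQ p hp μ hμ).2, zero_mul, neg_zero]
          exact Finset.sum_eq_zero fun J _ => zero_mul _
      rw [hQs]
      ring
    · rw [dilatinoVariation_eq hPQ _ hp]
      refine Finset.sum_eq_zero fun I _ => ?_
      rw [hrow p hp, mulVec_smul, hγξ p hp, smul_zero, Pi.zero_apply, zero_mul]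
  let T : (VecIdx → ℝ) →ₗ[ℝ] killingSpinors U hU (nullMetric om h) e P Q :=
    { toFun := fun c => ⟨ε c, hmem c⟩
      map_add' := fun c c' => by
        refine Subtype.ext (funext fun q => funext fun I => funext fun α => ?_)
        by_cases hq : q ∈ U
        · simp [ε, hq, add_mul]
        · simp [ε, hq]
      map_smul' := fun k c => by
        refine Subtype.ext (funext fun q => funext fun I => funext fun α => ?_)
        by_cases hq : q ∈ U
        · simp [ε, hq, mul_assoc]
        · simp [ε, hq] }
  have hT : Function.Injective T := by
    rw [← LinearMap.ker_eq_bot, LinearMap.ker_eq_bot']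
    intro c hc
    ext I
    have h1 : ∀ α, c I * ξ p₀ α = 0 := fun α => by
      have h2 : ε c p₀ I α = 0 := by
        have := congrArg Subtype.val hc
        exact congrFun (congrFun (congrFun this p₀) I) α
      rw [hεU c p₀ hp₀, hR0] at h2
      exact h2
    have h3 : c I * (ξ p₀ 0 ^ 2 + ξ p₀ 1 ^ 2) = 0 := by
      linear_combination ξ p₀ 0 * h1 0 + ξ p₀ 1 * h1 1
    exact (mul_eq_zero.1 h3).resolve_right (hξ0 p₀ hp₀)
  have hge := LinearMap.finrank_le_finrank_of_injective hT
  refine ⟨by rw [hsusy]; omega, ?_⟩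
  rintro ⟨p, hp, hPp⟩
  -- At a point with `P_v ≠ 0` the dilatino equation makes each `ηᴵ` parallel to `ξ`, so `ηᴵ` is
  -- determined by its inner product with `ξ`: 16 real numbers in all.
  let L : killingSpinors U hU (nullMetric om h) e P Q →ₗ[ℝ] (VecIdx → ℝ) :=
    { toFun := fun η I => ξ p 0 * η.1 p I 0 + ξ p 1 * η.1 p I 1
      map_add' := fun η η' => by ext I; simp; ring
      map_smul' := fun k η => by ext I; simp; ring }
  have hL : Function.Injective L := by
    rw [← LinearMap.ker_eq_bot, LinearMap.ker_eq_bot']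
    intro η hη
    refine hevp p hp (?_ : η.1 p = 0)
    have hdil : ∀ α I, (gammaCurved e 1 p *ᵥ η.1 p I) α = 0 := fun α => by
      refine congrFun (eq_zero_of_sum_gammaSO16_mulVec (P := P 1 p)
        (by rw [hPv p hp]; exact hPp) ?_)
      ext B
      have h1 := η.2.2.2.2 p hp B α
      rw [dilatinoVariation_eq hPQ _ hp] at h1
      simpa [Finset.sum_apply] using h1
    ext I α
    have h1 : ξ p 0 * η.1 p I 0 + ξ p 1 * η.1 p I 1 = 0 := congrFun hη I
    have h2 := hdil 0 I
    have h3 := hdil 1 I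
    rw [hξγ p hp] at h2 h3
    simp [mulVec, dotProduct, Fin.sum_univ_two] at h2 h3
    have hN := mul_ne_zero (mul_ne_zero two_ne_zero hs) (hξ0 p hp)
    fin_cases α
    · refine (mul_eq_zero.1 (?_ : 2 * s * (ξ p 0 ^ 2 + ξ p 1 ^ 2) * η.1 p I 0 = 0)).resolve_left hN
      linear_combination 2 * s * ξ p 0 * h1 + h3
    · refine (mul_eq_zero.1 (?_ : 2 * s * (ξ p 0 ^ 2 + ξ p 1 ^ 2) * η.1 p I 1 = 0)).resolve_left hN
      linear_combination 2 * s * ξ p 1 * h1 - h2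
  have hle := LinearMap.finrank_le_finrank_of_injective hL
  rw [hsusy, le_antisymm hle hge]

end Killing

/-! ### Rosen coordinates -/

section Rosen

open Matrix

/-- The equation `h₀'' = -N h₀` has a positive smooth solution near every point. -/
theorem exists_rosen_factor {N : ℝ → ℝ} {J : Set ℝ} (hJ : IsOpen J) (hJc : J.OrdConnected)
    (hN : ContDiffOn ℝ ∞ N J) {v₀ : ℝ} (hv₀ : v₀ ∈ J) :
    ∃ δ > 0, ∃ h₀ k : ℝ → ℝ, Set.Ioo (v₀ - δ) (v₀ + δ) ⊆ J ∧
      (∀ v ∈ Set.Ioo (v₀ - δ) (v₀ + δ), 0 < h₀ v ∧ HasDerivAt h₀ (k v) v ∧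
        HasDerivAt k (-(N v * h₀ v)) v) ∧
      ContDiffOn ℝ ∞ h₀ (Set.Ioo (v₀ - δ) (v₀ + δ)) ∧
      ContDiffOn ℝ ∞ k (Set.Ioo (v₀ - δ) (v₀ + δ)) := by
  -- First-order form for the pair `(h₀, h₀')` with initial value `(1, 0)`; continuity then keeps
  -- `h₀` positive near `v₀`.
  obtain ⟨R, hR0, hR⟩ := exists_linear_system_solution hJ hJc
    (B := fun v => (!![0, 1; -N v, 0] : Matrix (Fin 2) (Fin 2) ℝ))
    (fun i j => by
      fin_cases i <;> fin_cases j
      · exact continuousOn_const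
      · exact continuousOn_const
      · exact hN.continuousOn.neg
      · exact continuousOn_const) hv₀
  set y : ℝ → ℝ := fun v => R v ![1, 0] 0 with hy
  set k : ℝ → ℝ := fun v => R v ![1, 0] 1 with hk
  have hyd : ∀ v ∈ J, HasDerivAt y (k v) v := fun v hv => by
    refine (hR v hv ![1, 0] 0).congr_deriv ?_
    simp [hk]
  have hkd : ∀ v ∈ J, HasDerivAt k (-(N v * y v)) v := fun v hv => by
    refine (hR v hv ![1, 0] 1).congr_deriv ?_
    simp [hy]
  have hy0 : 0 < y v₀ := by simp [hy, hR0]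
  have hev : ∀ᶠ v in nhds v₀, v ∈ J ∧ 0 < y v :=
    (hJ.eventually_mem hv₀).and ((hyd v₀ hv₀).continuousAt.eventually (lt_mem_nhds hy0))
  obtain ⟨δ, hδ, hball⟩ := Metric.eventually_nhds_iff_ball.1 hev
  rw [Real.ball_eq_Ioo] at hball
  have hsub : Set.Ioo (v₀ - δ) (v₀ + δ) ⊆ J := fun v hv => (hball v hv).1
  -- Bootstrap: `y' = k` and `k' = -N y` with `N` smooth, so both functions gain an order together.
  have hsm : ∀ n : ℕ, ContDiffOn ℝ n y (Set.Ioo (v₀ - δ) (v₀ + δ)) ∧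
      ContDiffOn ℝ n k (Set.Ioo (v₀ - δ) (v₀ + δ)) := by
    intro n
    induction n with
    | zero =>
      refine ⟨contDiffOn_zero.2 fun v hv => ?_, contDiffOn_zero.2 fun v hv => ?_⟩
      · exact (hyd v (hsub hv)).continuousAt.continuousWithinAt
      · exact (hkd v (hsub hv)).continuousAt.continuousWithinAt
    | succ n ih =>
      have hNn : ContDiffOn ℝ n N (Set.Ioo (v₀ - δ) (v₀ + δ)) :=
        (hN.mono hsub).of_le (by exact_mod_cast le_top)
      push_cast
      refine ⟨(contDiffOn_succ_iff_deriv_of_isOpen isOpen_Ioo).2 ⟨fun v hv => ?_, by simp, ?_⟩,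
        (contDiffOn_succ_iff_deriv_of_isOpen isOpen_Ioo).2 ⟨fun v hv => ?_, by simp, ?_⟩⟩
      · exact (hyd v (hsub hv)).differentiableAt.differentiableWithinAt
      · exact ih.2.congr fun v hv => (hyd v (hsub hv)).deriv
      · exact (hkd v (hsub hv)).differentiableAt.differentiableWithinAt
      · exact (hNn.mul ih.1).neg.congr fun v hv => (hkd v (hsub hv)).deriv
  exact ⟨δ, hδ, y, k, hsub, fun v hv => ⟨(hball v hv).2, hyd v (hsub hv), hkd v (hsub hv)⟩,
    contDiffOn_infty.2 fun n => (hsm n).1, contDiffOn_infty.2 fun n => (hsm n).2⟩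

/-- A smooth injective map with invertible derivatives is a diffeomorphism onto an open set. -/
theorem exists_openPartialHomeomorph {E : Type*} [NormedAddCommGroup E] [NormedSpace ℝ E]
    [FiniteDimensional ℝ E] {s : Set E} (hs : IsOpen s) {Ψ : E → E} (hΨ : ContDiffOn ℝ ∞ Ψ s)
    (hinj : Set.InjOn Ψ s) (hd : ∀ p ∈ s, Function.Injective (fderiv ℝ Ψ p)) :
    ∃ Φ : OpenPartialHomeomorph E E, Φ.source = s ∧ ⇑Φ = Ψ ∧
      ContDiffOn ℝ ∞ Φ.symm Φ.target := by
  classical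
  have hcs : CompleteSpace E := FiniteDimensional.complete ℝ E
  have hc : ∀ p ∈ s, ContDiffAt ℝ ∞ Ψ p := fun p hp => (hΨ p hp).contDiffAt (hs.mem_nhds hp)
  have hequiv : ∀ p ∈ s, ∃ f' : E ≃L[ℝ] E, HasFDerivAt Ψ (f' : E →L[ℝ] E) p := fun p hp => by
    refine ⟨(LinearEquiv.ofInjectiveEndo (fderiv ℝ Ψ p : E →ₗ[ℝ] E)
      (hd p hp)).toContinuousLinearEquiv, ?_⟩
    refine (((hc p hp).differentiableAt (by simp)).hasFDerivAt).congr_fderiv ?_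
    ext w
    rfl
  -- The inverse function theorem gives openness; together with injectivity it yields a
  -- homeomorphism onto an open set.
  have hopen : IsOpenMap (s.domRestrict Ψ) := by
    refine isOpenMap_iff_nhds_le.2 fun x => ?_
    obtain ⟨f', hf'⟩ := hequiv x x.2
    have h1 := ((hc x x.2).hasStrictFDerivAt' hf' (by simp)).map_nhds_eq_of_equiv
    have h2 : Filter.map (s.domRestrict Ψ) (nhds x)
        = Filter.map Ψ (Filter.map Subtype.val (nhds x)) := rfl
    rw [h2, hs.isOpenEmbedding_subtypeVal.map_nhds_eq, h1]
    rfl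
  let Φ : OpenPartialHomeomorph E E := OpenPartialHomeomorph.ofContinuousOpenRestrict
    (hinj.toPartialEquiv Ψ s) hΨ.continuousOn hopen hs
  refine ⟨Φ, rfl, rfl, fun q hq => ?_⟩
  obtain ⟨f', hf'⟩ := hequiv (Φ.symm q) (Φ.map_target hq)
  exact (Φ.contDiffAt_symm hq hf' (hc _ (Φ.map_target hq))).contDiffWithinAt

/-- For a metric in Rosen form the field equations are `h₀'' + h₀ P_v P_v = 0`. -/
theorem nullEinstein_rosen_iff {h₀ k : ℝ → ℝ} {k' : ℝ} {I : Set ℝ} (hI : IsOpen I)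
    (hh₀ : ∀ v ∈ I, HasDerivAt h₀ (k v) v) {v : ℝ} (hv : v ∈ I) (hk : HasDerivAt k k' v)
    (hpos : 0 < h₀ v) (Pv : ℝ → SpinIdx → ℝ) (x : ℝ) :
    (NullEinstein (fun _ _ => 0) (fun v _ => h₀ v ^ 2) Pv v x ↔ RosenEquation h₀ Pv v) ∧
      (RosenEquation h₀ Pv v ↔ k' + h₀ v * (Pv v ⬝ᵥ Pv v) = 0) := by
  have hdd : deriv (deriv h₀) v = k' := by
    have h1 : deriv h₀ =ᶠ[nhds v] k := by
      filter_upwards [hI.mem_nhds hv] with s hs using (hh₀ s hs).deriv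
    rw [h1.deriv_eq, hk.deriv]
  have hR : RosenEquation h₀ Pv v ↔ k' + h₀ v * (Pv v ⬝ᵥ Pv v) = 0 := by
    rw [RosenEquation, hdd]
  refine ⟨?_, hR⟩
  have e1 : ∀ s ∈ I, dv (fun v _ => h₀ v ^ 2) s x = 2 * h₀ s * k s := fun s hs => by
    have := ((hh₀ s hs).fun_pow 2).deriv
    simpa [dv] using this
  have e2 : dv (dv (fun v _ => h₀ v ^ 2)) v x = 2 * (k v * k v + h₀ v * k') := by
    have h1 : (fun s => dv (fun v _ => h₀ v ^ 2) s x) =ᶠ[nhds v] fun s => 2 * h₀ s * k s := by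
      filter_upwards [hI.mem_nhds hv] with s hs using e1 s hs
    rw [dv, h1.deriv_eq, (((hh₀ v hv).const_mul 2).fun_mul hk).deriv]
    ring
  have e3 : dx (fun v _ => h₀ v ^ 2) v x = 0 := by simp [dx]
  have e4 : ∀ s, dv (fun _ _ => (0 : ℝ)) v s = 0 := fun s => by simp [dv]
  have e5 : dx (dv (fun _ _ => (0 : ℝ))) v x = 0 := by simp [dx, e4]
  rw [hR, NullEinstein, e2, e1 v hv, e3, e4, e5]
  have h0 := hpos.ne'
  rw [div_eq_iff (by positivity)]
  constructor
  · intro hE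
    have h3 : 4 * h₀ v ^ 3 * (k' + h₀ v * (Pv v ⬝ᵥ Pv v)) = 0 := by linear_combination -hE
    exact (mul_eq_zero.1 h3).resolve_left (by positivity)
  · intro hE
    linear_combination -(4 * h₀ v ^ 3) * hE

/-- The potentials that define Rosen coordinates. -/
theorem exists_rosen_potentials {D : Set (ℝ × ℝ)} (hD : IsOpen D) (hDc : Convex ℝ D)
    {om h : ℝ → ℝ → ℝ} (hom : Smooth₂ D om) (hh : Smooth₂ D h)
    (hpos : ∀ v x, (v, x) ∈ D → 0 < h v x) {N h₀ k : ℝ → ℝ}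
    (hh₀ : Smooth₂ D fun v _ => h₀ v) (hk : Smooth₂ D fun v _ => k v)
    (hode : ∀ v x, (v, x) ∈ D → 0 < h₀ v ∧ HasDerivAt h₀ (k v) v ∧ HasDerivAt k (-(N v * h₀ v)) v)
    (hE : ∀ v x, (v, x) ∈ D → ((dv h v x) ^ 2 + 2 * dx h v x * dv om v x
      - 2 * h v x * (2 * dx (dv om) v x + dv (dv h) v x)) / (4 * h v x ^ 2) = N v) :
    ∃ S X Z : ℝ → ℝ → ℝ, Smooth₂ D S ∧ Smooth₂ D X ∧ ∀ v x, (v, x) ∈ D →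
      dv X v x = Z v x / h₀ v ^ 2 ∧ dx X v x = √(h v x) / h₀ v ∧
      dv S v x = Z v x ^ 2 / (2 * h₀ v ^ 2) ∧ dx S v x = om v x + √(h v x) * Z v x / h₀ v := by
  -- Inserting `u + S`, `v`, `X` into the Rosen metric and comparing the coefficients of `dx²`, `dv
  -- dx` and `dv²` gives `∂_x X = √h / h₀`, `∂_x S = ω + h₀² ∂_v X ∂_x X` and `∂_v S = h₀² (∂_v X)²
  -- / 2`. The remaining freedom is `Z = h₀² ∂_v X`.
  set r : ℝ → ℝ → ℝ := fun v x => √(h v x) with hr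
  have hrs : Smooth₂ D r := ContDiffOn.sqrt hh fun y hy => (hpos _ _ hy).ne'
  have hr0 : ∀ v x, (v, x) ∈ D → r v x ≠ 0 := fun v x hy => (Real.sqrt_pos.2 (hpos v x hy)).ne'
  have hr2 : ∀ v x, (v, x) ∈ D → h v x = r v x ^ 2 := fun v x hy =>
    (Real.sq_sqrt (hpos v x hy).le).symm
  have hrv : ∀ v x, (v, x) ∈ D → HasDerivAt (fun s => r s x) (dv h v x / (2 * r v x)) v :=
    fun v x hy => (hh.hasDerivAt_dv hD hy).sqrt (hpos v x hy).ne'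
  have hrx : ∀ v x, (v, x) ∈ D → HasDerivAt (fun s => r v s) (dx h v x / (2 * r v x)) x :=
    fun v x hy => (hh.hasDerivAt_dx hD hy).sqrt (hpos v x hy).ne'
  have hh₀0 : ∀ v x, (v, x) ∈ D → h₀ v ≠ 0 := fun v x hy => (hode v x hy).1.ne'
  have h2r : Smooth₂ D fun v x => 2 * r v x := (smooth₂_const 2).mul hrs
  have h2r0 : ∀ v x, (v, x) ∈ D → 2 * r v x ≠ 0 := fun v x hy =>
    mul_ne_zero two_ne_zero (hr0 v x hy)
  -- The prescribed `∂_x Z` is what closedness of `dX` demands, and `∂_v Z` what closedness of `dS`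
  -- then demands. Closedness of `dZ` itself is the Einstein equation combined with `k' = -N h₀`.
  obtain ⟨Z, hZs, hZ⟩ := exists_smooth_potential hD hDc
    (a := fun v x => -(dv om v x * h₀ v / r v x))
    (b := fun v x => h₀ v * (dv h v x / (2 * r v x)) - k v * r v x)
    (((hom.dv hD).mul hh₀).div hrs hr0).neg
    ((hh₀.mul ((hh.dv hD).div h2r h2r0)).sub (hk.mul hrs)) (by
      intro v x hy
      have e1 : dx (fun v x => -(dv om v x * h₀ v / r v x)) v x = _ :=
        ((((hom.dv hD).hasDerivAt_dx hD hy).mul_const (h₀ v)).div (hrx v x hy) (hr0 v x hy)).neg.deriv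
      have e2 : dv (fun v x => h₀ v * (dv h v x / (2 * r v x)) - k v * r v x) v x = _ :=
        (((hode v x hy).2.1.mul (((hh.dv hD).hasDerivAt_dv hD hy).fun_div
          ((hrv v x hy).const_mul 2) (h2r0 v x hy))).sub
            ((hode v x hy).2.2.mul (hrv v x hy))).deriv
      rw [e1, e2, ← hE v x hy, hr2 v x hy]
      have := hr0 v x hy
      field_simp
      ring)
  have hZv : ∀ v x, (v, x) ∈ D → HasDerivAt (fun s => Z s x) (-(dv om v x * h₀ v / r v x)) v :=
    fun v x hy => (hZ v x hy).1 ▸ hZs.hasDerivAt_dv hD hy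
  have hZx : ∀ v x, (v, x) ∈ D → HasDerivAt (fun s => Z v s)
      (h₀ v * (dv h v x / (2 * r v x)) - k v * r v x) x :=
    fun v x hy => (hZ v x hy).2 ▸ hZs.hasDerivAt_dx hD hy
  have hh₀2 : Smooth₂ D fun v _ => h₀ v ^ 2 := ContDiffOn.pow hh₀ 2
  have hh₀20 : ∀ v x, (v, x) ∈ D → h₀ v ^ 2 ≠ 0 := fun v x hy => pow_ne_zero 2 (hh₀0 v x hy)
  obtain ⟨X, hXs, hX⟩ := exists_smooth_potential hD hDc
    (a := fun v x => Z v x / h₀ v ^ 2) (b := fun v x => r v x / h₀ v)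
    (hZs.div hh₀2 hh₀20) (hrs.div hh₀ hh₀0) (by
      intro v x hy
      have e1 : dx (fun v x => Z v x / h₀ v ^ 2) v x = _ :=
        ((hZx v x hy).div_const (h₀ v ^ 2)).deriv
      have e2 : dv (fun v x => r v x / h₀ v) v x = _ :=
        ((hrv v x hy).div (hode v x hy).2.1 (hh₀0 v x hy)).deriv
      rw [e1, e2]
      ring)
  obtain ⟨S, hSs, hS⟩ := exists_smooth_potential hD hDc
    (a := fun v x => Z v x ^ 2 / (2 * h₀ v ^ 2)) (b := fun v x => om v x + r v x * Z v x / h₀ v)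
    (Smooth₂.div (F := fun v x => Z v x ^ 2) (ContDiffOn.pow hZs 2) ((smooth₂_const 2).mul hh₀2)
      fun v x hy => mul_ne_zero two_ne_zero (hh₀20 v x hy))
    (hom.add ((hrs.mul hZs).div hh₀ hh₀0)) (by
      intro v x hy
      have e1 : dx (fun v x => Z v x ^ 2 / (2 * h₀ v ^ 2)) v x = _ :=
        (((hZx v x hy).pow 2).div_const (2 * h₀ v ^ 2)).deriv
      have e2 : dv (fun v x => om v x + r v x * Z v x / h₀ v) v x = _ :=
        ((hom.hasDerivAt_dv hD hy).add (((hrv v x hy).fun_mul (hZv v x hy)).fun_div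
          (hode v x hy).2.1 (hh₀0 v x hy))).deriv
      rw [e1, e2]
      have := hr0 v x hy
      have := hh₀0 v x hy
      field_simp
      ring)
  exact ⟨S, X, Z, hSs, hXs, fun v x hy => ⟨(hX v x hy).1, (hX v x hy).2, (hS v x hy).1,
    (hS v x hy).2⟩⟩

end Rosen

/-! ### The coordinate transformation to Rosen form -/

section RosenTransformation

/-- A function of `(v, x)` with positive `∂_x` is injective in `x`. -/
theorem Smooth₂.eq_of_dx_pos {D : Set (ℝ × ℝ)} (hD : IsOpen D) (hDc : Convex ℝ D)
    {X : ℝ → ℝ → ℝ} (hX : Smooth₂ D X) (hpos : ∀ v x, (v, x) ∈ D → 0 < MaxSugra.dx X v x)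
    {v x x' : ℝ} (hx : (v, x) ∈ D) (hx' : (v, x') ∈ D) (hXX : X v x = X v x') : x = x' := by
  have hso : IsOpen {s : ℝ | (v, s) ∈ D} := hD.preimage (by fun_prop : Continuous fun s : ℝ => (v, s))
  have hsc : Convex ℝ {s : ℝ | (v, s) ∈ D} := by
    intro a ha b hb s t hs ht hst
    have := hDc ha hb hs ht hst
    simpa [← add_mul, hst] using this
  have hm : StrictMonoOn (X v) {s : ℝ | (v, s) ∈ D} := by
    refine strictMonoOn_of_deriv_pos hsc
      (fun s hs => (hX.hasDerivAt_dx hD hs).continuousAt.continuousWithinAt) fun s hs => ?_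
    exact hpos v s (interior_subset (s := {s : ℝ | (v, s) ∈ D}) hs)
  exact hm.injOn hx hx' hXX

/-- The matrix of `fderiv` is the Jacobian. -/
theorem fderiv_apply_eq_jacobian {Ψ : Spacetime → Spacetime} {p : Spacetime}
    (hΨ : DifferentiableAt ℝ Ψ p) (w : Spacetime) : fderiv ℝ Ψ p w = jacobian Ψ p *ᵥ w := by
  funext ρ
  have h1 : fderiv ℝ (fun q => Ψ q ρ) p w = fderiv ℝ Ψ p w ρ := by
    have h := ((hasFDerivAt_apply ρ (Ψ p)).comp p hΨ.hasFDerivAt).fderiv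
    exact congrArg (· w) h
  have h2 : w = ∑ μ, w μ • (Pi.single μ 1 : Spacetime) := by
    simpa using pi_eq_sum_univ' w
  rw [← h1]
  conv_lhs => rw [h2]
  rw [map_sum]
  simp only [map_smul, smul_eq_mul, Matrix.mulVec, dotProduct, jacobian, Matrix.of_apply, pd]
  exact Finset.sum_congr rfl fun μ _ => mul_comm _ _

/-- A solution of the null class can be brought to Rosen form near every value of `v`. -/
theorem exists_rosen_transformation {U : Set Spacetime} (hU : IsOpen U) (hUc : Convex ℝ U)
    {om h : ℝ → ℝ → ℝ} (hom : Smooth₂ (vxDomain U) om) (hh : Smooth₂ (vxDomain U) h)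
    (hpos : ∀ p ∈ U, 0 < h (p 1) (p 2)) {Pv : ℝ → SpinIdx → ℝ}
    (hPv : ∀ A, ContDiffOn ℝ ∞ (fun v => Pv v A) (vDomain U))
    (hE : ∀ p ∈ U, NullEinstein om h Pv (p 1) (p 2)) {p₀ : Spacetime} (hp₀ : p₀ ∈ U) :
    ∃ δ > 0, ∃ (Ψ : OpenPartialHomeomorph Spacetime Spacetime) (h₀ : ℝ → ℝ),
      Ψ.source = {p | p ∈ U ∧ p 1 ∈ Set.Ioo (p₀ 1 - δ) (p₀ 1 + δ)} ∧
      (∀ p ∈ Ψ.source, Ψ p 1 = p 1) ∧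
      ContDiffOn ℝ ∞ h₀ (Set.Ioo (p₀ 1 - δ) (p₀ 1 + δ)) ∧
      (∀ v ∈ Set.Ioo (p₀ 1 - δ) (p₀ 1 + δ), 0 < h₀ v) ∧
      BringsMetricTo Ψ (nullMetric om h) (nullMetric (fun _ _ => 0) (fun v _ => h₀ v ^ 2)) ∧
      (∀ v ∈ Set.Ioo (p₀ 1 - δ) (p₀ 1 + δ),
        (∀ x, NullEinstein (fun _ _ => 0) (fun v _ => h₀ v ^ 2) Pv v x
          ↔ RosenEquation h₀ Pv v) ∧
        RosenEquation h₀ Pv v) := by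
  have hN : ContDiffOn ℝ ∞ (fun v => Pv v ⬝ᵥ Pv v) (vDomain U) :=
    ContDiffOn.sum fun A _ => (hPv A).mul (hPv A)
  obtain ⟨δ, hδ, h₀, k, -, hode, hh₀, hk⟩ := exists_rosen_factor (isOpen_vDomain hU)
    (ordConnected_vDomain hUc) hN (v₀ := p₀ 1) ⟨p₀, hp₀, rfl⟩
  set I : Set ℝ := Set.Ioo (p₀ 1 - δ) (p₀ 1 + δ) with hI
  -- The slab is convex, hence so is its projection to the `(v, x)` plane, and the potentials exist
  -- over all of it.
  set s : Set Spacetime := {p | p ∈ U ∧ p 1 ∈ I} with hs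
  have hsU : s ⊆ U := fun p hp => hp.1
  have hso : IsOpen s := hU.inter (isOpen_Ioo.preimage (continuous_apply 1))
  have hsc : Convex ℝ s := hUc.inter
    ((convex_Ioo _ _).linear_preimage (LinearMap.proj (R := ℝ) (φ := fun _ : Fin 3 => ℝ) 1))
  have hD := isOpen_vxDomain hso
  have hDc := convex_vxDomain hsc
  have hsub : vxDomain s ⊆ vxDomain U := Set.image_mono hsU
  have hfst : ∀ {G : ℝ → ℝ}, ContDiffOn ℝ ∞ G I → Smooth₂ (vxDomain s) fun v _ => G v :=
    fun hG => hG.comp (f := fun y : ℝ × ℝ => y.1) contDiffOn_fst (by rintro _ ⟨p, hp, rfl⟩; exact hp.2)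
  have hposD : ∀ v x, (v, x) ∈ vxDomain s → 0 < h v x := by
    rintro _ _ ⟨p, hp, ⟨⟩⟩
    exact hpos p hp.1
  have hodeD : ∀ v x, (v, x) ∈ vxDomain s → 0 < h₀ v ∧ HasDerivAt h₀ (k v) v ∧
      HasDerivAt k (-((Pv v ⬝ᵥ Pv v) * h₀ v)) v := by
    rintro _ _ ⟨p, hp, ⟨⟩⟩
    exact hode _ hp.2
  obtain ⟨S, X, Z, hS, hX, hSX⟩ := exists_rosen_potentials hD hDc (hom.mono hsub) (hh.mono hsub)
    hposD (N := fun v => Pv v ⬝ᵥ Pv v) (hfst hh₀) (hfst hk) hodeD (by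
      rintro _ _ ⟨p, hp, ⟨⟩⟩
      exact hE p hp.1)
  have hXpos : ∀ v x, (v, x) ∈ vxDomain s → 0 < dx X v x := fun v x hy => by
    rw [(hSX v x hy).2.1]
    exact div_pos (Real.sqrt_pos.2 (hposD v x hy)) (hodeD v x hy).1
  set Ψ : Spacetime → Spacetime := fun p => ![p 0 + S (p 1) (p 2), p 1, X (p 1) (p 2)] with hΨ
  have hΨs : ContDiffOn ℝ ∞ Ψ s := by
    refine contDiffOn_pi.2 fun ρ => ?_
    fin_cases ρ
    · exact (contDiff_apply ℝ ℝ (0 : Fin 3)).contDiffOn.add hS.comp_spacetime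
    · exact (contDiff_apply ℝ ℝ (1 : Fin 3)).contDiffOn
    · exact hX.comp_spacetime
  have hjac : ∀ p ∈ s, jacobian Ψ p = !![1, dv S (p 1) (p 2), dx S (p 1) (p 2); 0, 1, 0;
      0, dv X (p 1) (p 2), dx X (p 1) (p 2)] := by
    intro p hp
    have hy := mem_vxDomain hp
    have hc : ∀ i μ : Fin 3, pd μ (fun q => q i) p = (Pi.single μ 1 : Spacetime) i := fun i μ => by
      rw [pd, (hasFDerivAt_apply i p).fderiv]
      rfl
    have r0 : ∀ μ, pd μ (fun q => Ψ q 0) p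
        = (Pi.single μ 1 : Spacetime) 0 + ![0, dv S (p 1) (p 2), dx S (p 1) (p 2)] μ := fun μ => by
      rw [← hc, ← hS.pd hD hy μ]
      exact pd_add (hasFDerivAt_apply 0 p).differentiableAt
        (hS.hasFDerivAt_spacetime hD hy).differentiableAt μ
    have r1 : ∀ μ, pd μ (fun q => Ψ q 1) p = (Pi.single μ 1 : Spacetime) 1 := hc 1
    have r2 : ∀ μ, pd μ (fun q => Ψ q 2) p = ![0, dv X (p 1) (p 2), dx X (p 1) (p 2)] μ :=
      hX.pd hD hy
    ext ρ μ
    rw [jacobian, Matrix.of_apply]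
    fin_cases ρ
    · exact (r0 μ).trans (by fin_cases μ <;> simp)
    · exact (r1 μ).trans (by fin_cases μ <;> simp)
    · exact (r2 μ).trans (by fin_cases μ <;> simp)
  -- The map keeps `v`; on a slice of constant `v` the function `X` is strictly increasing in `x`;
  -- and `u` is only shifted by `S`.
  have hinj : Set.InjOn Ψ s := by
    intro p hp q hq hpq
    have e0 : p 0 + S (p 1) (p 2) = q 0 + S (q 1) (q 2) := congrFun hpq 0
    have e1 : p 1 = q 1 := congrFun hpq 1
    have e2 : X (p 1) (p 2) = X (q 1) (q 2) := congrFun hpq 2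
    have hq' := mem_vxDomain hq
    rw [← e1] at e0 e2 hq'
    have e3 := hX.eq_of_dx_pos hD hDc hXpos (mem_vxDomain hp) hq' e2
    rw [← e3] at e0
    funext i
    fin_cases i
    · exact add_right_cancel e0
    · exact e1
    · exact e3
  have hd : ∀ p ∈ s, Function.Injective (fderiv ℝ Ψ p) := by
    intro p hp
    refine (injective_iff_map_eq_zero _).2 fun w hw => ?_
    have hdiff : DifferentiableAt ℝ Ψ p :=
      ((hΨs p hp).contDiffAt (hso.mem_nhds hp)).differentiableAt (by simp)
    rw [fderiv_apply_eq_jacobian hdiff, hjac p hp] at hw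
    have w0 := congrFun hw 0
    have w1 := congrFun hw 1
    have w2 := congrFun hw 2
    simp [Matrix.mulVec, dotProduct, Fin.sum_univ_three] at w0 w1 w2
    have hx0 := (hXpos _ _ (mem_vxDomain hp)).ne'
    have e2 : w 2 = 0 := by simpa [w1, hx0] using w2
    funext i
    fin_cases i
    · simpa [w1, e2] using w0
    · exact w1
    · exact e2
  obtain ⟨Φ, hΦs, hΦ, hΦi⟩ := exists_openPartialHomeomorph hso hΨs hinj hd
  refine ⟨δ, hδ, Φ, h₀, hΦs, fun p _ => by rw [hΦ]; rfl, hh₀, fun v hv => (hode v hv).1,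
    ⟨by rw [hΦ, hΦs]; exact hΨs, hΦi, fun p hp => ?_⟩, fun v hv => ?_⟩
  · rw [hΦs] at hp
    rw [hΦ, hjac p hp]
    obtain ⟨e1, e2, e3, e4⟩ := hSX _ _ (mem_vxDomain hp)
    rw [e1, e2, e3, e4]
    have hr := Real.sq_sqrt (hpos p hp.1).le
    have hn := (hode _ hp.2).1.ne'
    have hΨ1 : Ψ p 1 = p 1 := rfl
    ext μ ν
    simp only [nullMetric, hΨ1]
    fin_cases μ <;> fin_cases ν <;>
      simp [Matrix.mul_apply, Fin.sum_univ_three] <;> field_simp <;> (try rw [hr]) <;> ring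
  · have hiff := fun x => nullEinstein_rosen_iff isOpen_Ioo (fun v hv => (hode v hv).2.1) hv
      (hode v hv).2.2 (hode v hv).1 Pv x
    -- The Rosen equation does not involve `x`, so the value 0 is arbitrary; the equation holds by
    -- the construction of `h₀`.
    exact ⟨fun x => (hiff x).1, (hiff 0).2.2 (by ring)⟩

end RosenTransformation

end MaxSugra

/-! ### The theorem on the null class -/

theorem mainTheorem3
    (U : Set Spacetime) (hUo : IsOpen U) (hUc : Convex ℝ U) (hUn : U.Nonempty)
    (om h : ℝ → ℝ → ℝ) (V : Spacetime → E8Group)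
    (P : Fin 3 → Spacetime → SpinIdx → ℝ) (Q : Fin 3 → Spacetime → SO16Alg)
    (hN : IsNullClass U om h V P Q) :
    ∃ Pv : ℝ → SpinIdx → ℝ,
      -- the only non-zero component of `P` is `P_v`, a function of `v`
      (∀ p ∈ U, P 0 p = 0 ∧ P 1 p = Pv (p 1) ∧ P 2 p = 0) ∧
      -- the field equations amount to a single equation
      (FieldEquations U (nullMetric om h) P Q ↔
        ∀ p ∈ U, NullEinstein om h Pv (p 1) (p 2)) ∧
      -- a solution preserves half of the supersymmetry, and no more unless the scalars are constant
      (FieldEquations U (nullMetric om h) P Q →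
        ∀ e : Spacetime → Matrix (Fin 3) (Fin 3) ℝ, IsVielbein U (nullMetric om h) e →
          Module.finrank ℝ SusyParam
              ≤ 2 * Module.finrank ℝ (killingSpinors U hUo (nullMetric om h) e P Q) ∧
          ((∃ p ∈ U, Pv (p 1) ≠ 0) →
            2 * Module.finrank ℝ (killingSpinors U hUo (nullMetric om h) e P Q)
              = Module.finrank ℝ SusyParam)) ∧
      -- if the auxiliary equation is solvable, the metric can be brought to Rosen form
      (FieldEquations U (nullMetric om h) P Q →
        (∀ p ∈ U, dv om (p 1) (p 2) ≠ 0) →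
        (∃ (f : ℝ → ℝ → ℝ) (c : ℝ),
          ContDiffOn ℝ 2 (fun y : ℝ × ℝ => f y.1 y.2) (vxDomain U) ∧
          ∀ p ∈ U, AuxiliaryEquation om h f c (p 1) (p 2)) →
        ∀ p₀ ∈ U, ∃ δ > 0, ∃ (Ψ : OpenPartialHomeomorph Spacetime Spacetime) (h₀ : ℝ → ℝ),
          Ψ.source = {p | p ∈ U ∧ p 1 ∈ Set.Ioo (p₀ 1 - δ) (p₀ 1 + δ)} ∧
          (∀ p ∈ Ψ.source, Ψ p 1 = p 1) ∧
          ContDiffOn ℝ ∞ h₀ (Set.Ioo (p₀ 1 - δ) (p₀ 1 + δ)) ∧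
          (∀ v ∈ Set.Ioo (p₀ 1 - δ) (p₀ 1 + δ), 0 < h₀ v) ∧
          BringsMetricTo Ψ (nullMetric om h)
            (nullMetric (fun _ _ => 0) (fun v _ => h₀ v ^ 2)) ∧
          (∀ v ∈ Set.Ioo (p₀ 1 - δ) (p₀ 1 + δ),
            (∀ x, NullEinstein (fun _ _ => 0) (fun v _ => h₀ v ^ 2) Pv v x
              ↔ RosenEquation h₀ Pv v) ∧
            RosenEquation h₀ Pv v)) := by
  have hV := hN.scalars
  have hMC := fun p hp q hq hpq μ =>
    maurerCartan_eq_of_eq hUo hV hN.scalars_v (p := p) (q := q) hp hq hpq μ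
  have hPQ : ∀ p ∈ U, ∀ μ, μ ≠ 1 → P μ p = 0 ∧ Q μ p = 0 := fun p hp μ hμ =>
    maurerCartan_eq_zero hUo hV hN.scalars_v hp hμ
  obtain ⟨Pv, hPv⟩ := exists_factor_v (F := P 1) fun p hp q hq hpq => (hMC p hp q hq hpq 1).1
  -- Supplies the default value of `Qv` at those `v` that do not occur on `U`.
  have : Inhabited SO16Alg := ⟨0⟩
  obtain ⟨Qv, hQv⟩ := exists_factor_v (F := Q 1) fun p hp q hq hpq => (hMC p hp q hq hpq 1).2
  have h0 : ∀ v x, (v, x) ∈ vxDomain U → h v x ≠ 0 := by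
    rintro _ _ ⟨p, hp, ⟨⟩⟩
    exact (hN.h_pos p hp).ne'
  have hiff := fieldEquations_null_iff hUo hN.smooth_om hN.smooth_h h0 hPQ hPv
  refine ⟨Pv, fun p hp => ⟨(hPQ p hp 0 (by decide)).1, hPv p hp, (hPQ p hp 2 (by decide)).1⟩,
    hiff, fun _ e he => ?_, fun hF _ _ p₀ hp₀ => ?_⟩
  · exact finrank_killingSpinors hUo hUc hUn hN.smooth_om hN.smooth_h h0 he hPQ hPv hV.smooth_Q hQv
  · exact exists_rosen_transformation hUo hUc hN.smooth_om hN.smooth_h hN.h_pos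
      (fun A => contDiffOn_of_factor_v hUo (hV.smooth_P 1 A) fun p hp => congrFun (hPv p hp) A)
      (hiff.1 hF) hp₀
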